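/- Let $k$ be a commutative ring and let $\mathcal C$ be a small $k$-category (a category enriched in $k$-modules). Write $\mathrm{Hom}(c,d)$ for its Hom modules and $\otimes$ for $\otimes_k$. Assume: - $\mathcal C$ is locally bounded: for every object $c$ there are only finitely many objects $d$ with $\mathrm{Hom}(d,c)\neq 0$ and only finitely many objects $d$ with $\mathrm{Hom}(c,d)\neq 0$; - $\mathcal C$ is Hom-finite: every $\mathrm{Hom}(c,d)$ is a finitely generated projective $k$-module; - $\mathcal C$ has a Serre functor relative to $k$: a $k$-linear self-equivalence $S\colon\mathcal C\to\mathcal C$ together with $k$-linear isomorphisms $\sigma_{c,d}\colon \mathrm{Hom}(c,d)\cong \mathrm{Hom}_k(\mathrm{Hom}(d,Sc),k)$, natural in $c,d\in\mathcal C$. A Gorenstein category is a Grothendieck category $\mathcal A$ such that (1) an object has finite projective dimension if and only if it has finite injective dimension; (2) the finitary projective dimension $\sup\{\operatorname{pd}A \mid \operatorname{pd}A<\infty\}$ and the finitary injective dimension $\sup\{\operatorname{id}A\mid \operatorname{id}A<\infty\}$ are finite (zero objects contribute $0$ to these suprema); (3) $\mathcal A$ has a generator of finite projective dimension. It is $n$-Gorenstein,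 $n\in\mathbb N$, if moreover its finitary projective and finitary injective dimensions are both equal to $n$. A (not necessarily commutative) $k$-algebra $R$ is $n$-Gorenstein if the category of right $R$-modules is $n$-Gorenstein, and a small $k$-category $\mathcal D$ is $n$-Gorenstein if the category of right $\mathcal D$-modules, i.e. of $k$-linear functors $\mathcal D^{\mathrm{op}}\to \mathrm{Mod}\,k$, is $n$-Gorenstein. For a $k$-algebra $R$ let $R\otimes\mathcal C$ be the $k$-category with the same objects as $\mathcal C$, Hom modules $R\otimes \mathrm{Hom}(c,d)$ and composition $(s\otimes g)\circ(r\otimes f)=sr\otimes gf$. **Theorem.** If $R$ is any $n$-Gorenstein $k$-algebra, then $R\otimes\mathcal C$ is $n'$-Gorenstein for some $n'\le n$. If moreover $\mathcal C$ has at least one object and, for every object $c$, the unit $R\to R\otimes \mathrm{End}(c)$, $r\mapsto r\otimes 1_c$, has a right $R$-linear retraction, then $n'=n$. -/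

import Mathlib

open CategoryTheory CategoryTheory.Limits
open scoped TensorProduct

universe u v w

section GorensteinCategories

/-! ### Gorenstein abelian categories -/

variable (A : Type w) [Category.{v} A] [Abelian A]

/-- The finitary projective dimension: the supremum of the projective dimensions of the objects of
finite projective dimension. (Mathlib gives the zero object dimension `⊥`; here it contributes `0`,
so that the supremum is always a natural number or `∞`.) -/
noncomputable def finitaryProjectiveDimension : ℕ∞ :=
  ⨆ (X : A) (_ : projectiveDimension X ≠ ⊤), (projectiveDimension X).unbotD 0

/-- The finitary injective dimension: the supremum of the injective dimensions of the objects of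
finite injective dimension. -/
noncomputable def finitaryInjectiveDimension : ℕ∞ :=
  ⨆ (X : A) (_ : injectiveDimension X ≠ ⊤), (injectiveDimension X).unbotD 0

/-- A Gorenstein category: a Grothendieck category in which finite projective dimension is the same
as finite injective dimension, the two finitary dimensions are finite, and which has a generator of
finite projective dimension. -/
structure IsGorensteinCategory : Prop where
  grothendieck : IsGrothendieckAbelian.{v} A
  finite_iff : ∀ X : A, projectiveDimension X ≠ ⊤ ↔ injectiveDimension X ≠ ⊤
  finitaryProjectiveDimension_ne_top : finitaryProjectiveDimension A ≠ ⊤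
  finitaryInjectiveDimension_ne_top : finitaryInjectiveDimension A ≠ ⊤
  exists_generator : ∃ G : A, IsSeparator G ∧ projectiveDimension G ≠ ⊤

/-- `A` is `n`-Gorenstein: a Gorenstein category whose Gorenstein dimension, i.e. the common value
of its finitary projective and finitary injective dimensions, is `n`. -/
structure IsNGorensteinCategory (n : ℕ) : Prop where
  isGorenstein : IsGorensteinCategory A
  finitaryProjectiveDimension_eq : finitaryProjectiveDimension A = n
  finitaryInjectiveDimension_eq : finitaryInjectiveDimension A = n

end GorensteinCategories

/-- A (not necessarily commutative) ring `R` is `n`-Gorenstein if the category of right `R`-modules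
is `n`-Gorenstein. -/
def IsNGorensteinRing (R : Type u) [Ring R] (n : ℕ) : Prop :=
  IsNGorensteinCategory (ModuleCat.{u} Rᵐᵒᵖ) n

section RightModules

/-! ### Right modules over a small `k`-category -/

variable (k : Type u) [CommRing k] (D : Type u) [Category.{u} D] [Preadditive D] [Linear k D]

/-- The `k`-linear functors among the contravariant functors from `D` to `k`-modules. -/
def isLinearPresheaf : ObjectProperty (Dᵒᵖ ⥤ ModuleCat.{u} k) := fun F =>
  (∀ ⦃c d : D⦄ (f g : c ⟶ d), F.map (f + g).op = F.map f.op + F.map g.op) ∧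
    ∀ ⦃c d : D⦄ (r : k) (f : c ⟶ d), F.map (r • f).op = r • F.map f.op

/-- The category `Mod D` of right `D`-modules: `k`-linear functors `Dᵒᵖ ⥤ Mod k` and natural
transformations. -/
abbrev RightMod : Type (u + 1) := (isLinearPresheaf k D).FullSubcategory

instance : (isLinearPresheaf k D).ContainsZero where
  exists_zero := by
    have h0 : IsZero ((Functor.const Dᵒᵖ).obj (ModuleCat.of k PUnit.{u + 1})) := by
      rw [Functor.isZero_iff]
      intro X
      exact ModuleCat.isZero_of_subsingleton (ModuleCat.of k PUnit.{u + 1})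
    have h1 : ∀ X, IsZero (((Functor.const Dᵒᵖ).obj (ModuleCat.of k PUnit.{u + 1})).obj X) :=
      (Functor.isZero_iff _).1 h0
    exact ⟨_, h0, fun c d f g => (h1 _).eq_of_src _ _, fun c d r f => (h1 _).eq_of_src _ _⟩

instance : (isLinearPresheaf k D).IsClosedUnderSubobjects where
  prop_of_mono {X Y} i _ hY := by
    refine ⟨fun c d f g => ?_, fun c d r f => ?_⟩
    · rw [← cancel_mono (i.app (Opposite.op c))]
      simp [-op_add, hY.1]
    · rw [← cancel_mono (i.app (Opposite.op c))]
      simp [hY.2]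

instance : (isLinearPresheaf k D).IsClosedUnderQuotients where
  prop_of_epi {X Y} p _ hX := by
    refine ⟨fun c d f g => ?_, fun c d r f => ?_⟩
    · rw [← cancel_epi (p.app (Opposite.op d))]
      simp [-op_add, ← NatTrans.naturality, hX.1]
    · rw [← cancel_epi (p.app (Opposite.op d))]
      simp [← NatTrans.naturality, hX.2]

instance : (isLinearPresheaf k D).IsClosedUnderFiniteProducts where
  isClosedUnderLimitsOfShape J _ := by
    refine ⟨?_⟩
    rintro X ⟨p⟩
    refine ⟨fun c d f g => ?_, fun c d r f => ?_⟩
    · refine (isLimitOfPreserves ((evaluation _ _).obj (Opposite.op c)) p.isLimit).hom_ext ?_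
      intro j
      simp [-op_add, (p.prop_diag_obj j).1]
    · refine (isLimitOfPreserves ((evaluation _ _).obj (Opposite.op c)) p.isLimit).hom_ext ?_
      intro j
      simp [(p.prop_diag_obj j).2]

noncomputable instance : Abelian (RightMod k D) := inferInstance

/-- The small `k`-category `D` is `n`-Gorenstein if `Mod D` is. -/
def IsNGorensteinSmallCategory (n : ℕ) : Prop := IsNGorensteinCategory (RightMod k D) n

end RightModules

section ScalarExtension

/-! ### The `k`-category `R ⊗ C` -/

/-- The objects of `R ⊗ C`: those of `C`. -/
structure ScalarExt (k R C : Type u) : Type u where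
  obj : C

variable (k R C : Type u) [CommRing k] [Ring R] [Algebra k R]
  [Category.{u} C] [Preadditive C] [Linear k C]

namespace ScalarExt

/-- Composition in `R ⊗ C`, in diagrammatic order: `(r ⊗ f, s ⊗ g) ↦ s r ⊗ (f ≫ g)`. -/
noncomputable def compMap (c d e : C) :
    (R ⊗[k] (c ⟶ d)) →ₗ[k] (R ⊗[k] (d ⟶ e)) →ₗ[k] (R ⊗[k] (c ⟶ e)) :=
  TensorProduct.map₂ (LinearMap.mul k R).flip (Linear.comp (S := k) c d e)

variable {k R C} in
lemma compMap_tmul {c d e : C} (r s : R) (f : c ⟶ d) (g : d ⟶ e) :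
    compMap k R C c d e (r ⊗ₜ[k] f) (s ⊗ₜ[k] g) = (s * r) ⊗ₜ[k] (f ≫ g) := by
  simp [compMap]

lemma one_compMap (c d : C) : compMap k R C c c d (1 ⊗ₜ[k] 𝟙 c) = LinearMap.id := by
  ext s g
  simp [compMap_tmul]

lemma compMap_one (c d : C) :
    (compMap k R C c d d).flip (1 ⊗ₜ[k] 𝟙 d) = LinearMap.id := by
  ext s g
  simp [compMap_tmul]

variable {k R C} in
lemma compMap_assoc {a b c d : C} (x : R ⊗[k] (a ⟶ b)) (y : R ⊗[k] (b ⟶ c))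
    (z : R ⊗[k] (c ⟶ d)) :
    compMap k R C a c d (compMap k R C a b c x y) z =
      compMap k R C a b d x (compMap k R C b c d y z) := by
  induction x using TensorProduct.induction_on with
  | zero => simp
  | add x x' hx hx' => simp [hx, hx']
  | tmul r f =>
    induction y using TensorProduct.induction_on with
    | zero => simp
    | add y y' hy hy' => simp [hy, hy']
    | tmul s g =>
      induction z using TensorProduct.induction_on with
      | zero => simp
      | add z z' hz hz' => simp [hz, hz']
      | tmul t h => simp [compMap_tmul, mul_assoc]

noncomputable instance : Category.{u} (ScalarExt k R C) where
  Hom c d := R ⊗[k] (c.obj ⟶ d.obj)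
  id c := 1 ⊗ₜ[k] 𝟙 c.obj
  comp {c d e} x y := compMap k R C c.obj d.obj e.obj x y
  id_comp x := LinearMap.congr_fun (one_compMap k R C _ _) x
  comp_id x := LinearMap.congr_fun (compMap_one k R C _ _) x
  assoc x y z := compMap_assoc x y z

noncomputable instance : Preadditive (ScalarExt k R C) where
  homGroup c d := inferInstanceAs (AddCommGroup (R ⊗[k] (c.obj ⟶ d.obj)))
  add_comp c d e x x' y :=
    LinearMap.map_add₂ (compMap k R C c.obj d.obj e.obj) x x' y
  comp_add c d e x y y' :=
    (compMap k R C c.obj d.obj e.obj x).map_add y y'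

noncomputable instance : Linear k (ScalarExt k R C) where
  homModule c d := inferInstanceAs (Module k (R ⊗[k] (c.obj ⟶ d.obj)))
  smul_comp c d e r x y :=
    LinearMap.map_smul₂ (compMap k R C c.obj d.obj e.obj) r x y
  comp_smul c d e x r y :=
    (compMap k R C c.obj d.obj e.obj x).map_smul r y

end ScalarExt

end ScalarExtension

section SerreFunctors

/-! ### Hom-finiteness, local boundedness, Serre functors -/

variable (k C : Type u) [CommRing k] [Category.{u} C] [Preadditive C] [Linear k C]

/-- All Hom modules are finitely generated projective over `k`. -/
def IsHomFinite : Prop :=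
  ∀ c d : C, Module.Finite k (c ⟶ d) ∧ Module.Projective k (c ⟶ d)

/-- Every object receives nonzero morphisms from, and has nonzero morphisms to, only finitely many
objects. -/
def IsLocallyBounded (C : Type u) [Category.{u} C] [Preadditive C] : Prop :=
  ∀ c : C, {d : C | ∃ f : d ⟶ c, f ≠ 0}.Finite ∧ {d : C | ∃ f : c ⟶ d, f ≠ 0}.Finite

/-- A Serre functor on `C` relative to `k`: a `k`-linear self-equivalence `S` with `k`-linear
isomorphisms `Hom(c, d) ≅ Hom_k(Hom(d, S c), k)`, natural in `c` and `d`. -/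
structure SerreFunctor where
  S : C ≌ C
  additive : S.functor.Additive
  linear : S.functor.Linear k
  σ (c d : C) : (c ⟶ d) ≃ₗ[k] Module.Dual k (d ⟶ S.functor.obj c)
  naturality_left {c c' d : C} (h : c' ⟶ c) (f : c ⟶ d) (g : d ⟶ S.functor.obj c') :
    σ c' d (h ≫ f) g = σ c d f (g ≫ S.functor.map h)
  naturality_right {c d d' : C} (f : c ⟶ d) (h : d ⟶ d') (g : d' ⟶ S.functor.obj c) :
    σ c d' (f ≫ h) g = σ c d f (h ≫ g)

end SerreFunctors

/-!
The category of right `R ⊗ C`-modules behaves like the category of modules over a Frobenius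
extension of `R`: restriction to objects has a right adjoint, coinduction, and the Serre functor
turns it into a left adjoint as well.

Write `A` for the category of right `R ⊗ C`-modules. A Grothendieck category with a projective
separator is Gorenstein of dimension `≤ n` as soon as its projectives have injective dimension `≤ n`
and its injectives have projective dimension `≤ n` (`exists_isNGorensteinCategory`): dimension
shifting gives everything but the equality of the two finitary dimensions, and that holds because
the top nonvanishing `Ext` out of an object of finite projective dimension is already nonzero on a
projective.

The projectives and injectives of `A` are reached through coinduction. For objects `a i` and right
`R`-modules `X i`, let `coind a X` be the module `c ↦ ∏ i, Hom_k(Hom(a i, c), X i)`. As the Hom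
modules are projective, this is exact in `X` (`shortExact_coindMap`). Morphisms `M ⟶ coind a X` are
families `M (a i) ⟶ X i`, so `coind a X` is injective when all `X i` are. If moreover there are
traces `τ i : Hom(a i, b i) → k` for which `Hom(a i, d)` and `Hom(d, b i)` have dual bases for all
`d`, then `Hom_k(Hom(a i, d), X i)` is `X i ⊗ Hom(d, b i)`, and by local boundedness the product
over `i` is a direct sum. Hence morphisms `coind a X ⟶ M` are families `X i ⟶ M (b i)`, and
`coind a X` is projective when all `X i` are (`projective_coind`). The Serre functor provides such traces for the
pairs `(c, S c)` and `(S⁻¹ c, c)`. From the second, every module is a quotient of some `coind a X`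
with projective `X i`, and a projective module is a summand of it, so has injective dimension `≤ n`;
from the first, every injective module is a summand of some `coind a X` with injective `X i`, so has
projective dimension `≤ n`.

For the equality `n' = n`, a retraction of `R → R ⊗ End c` makes each free right `R`-module `F` a
summand of the value at `c` of the projective module coinduced from `F`. That module has injective
dimension `≤ n'`, and evaluation at `c` is exact and preserves injectives. So projective right
`R`-modules have injective dimension `≤ n'`, which bounds the finitary projective dimension `n` of
`R`.
-/

section HomologicalDimension

/-! ### Finitary dimensions and a criterion for Gorenstein categories -/

open Abelian

variable {A : Type w} [Category.{v} A] [Abelian A]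

lemma finitaryProjectiveDimension_le_iff (n : ℕ) :
    finitaryProjectiveDimension A ≤ n ↔
      ∀ X : A, projectiveDimension X ≠ ⊤ → HasProjectiveDimensionLE X n := by
  simp only [finitaryProjectiveDimension, iSup_le_iff, ← projectiveDimension_le_iff]
  refine forall₂_congr fun X _ => ?_
  rw [WithBot.unbotD_le_iff (fun _ => zero_le)]
  rfl

lemma finitaryInjectiveDimension_le_iff (n : ℕ) :
    finitaryInjectiveDimension A ≤ n ↔
      ∀ X : A, injectiveDimension X ≠ ⊤ → HasInjectiveDimensionLE X n := by
  simp only [finitaryInjectiveDimension, iSup_le_iff, ← injectiveDimension_le_iff]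
  refine forall₂_congr fun X _ => ?_
  rw [WithBot.unbotD_le_iff (fun _ => zero_le)]
  rfl

/-- If projectives have injective dimension `≤ m`, then the top nonvanishing `Ext` out of an object
of finite projective dimension, being right exact, is already nonzero on a projective, so it lies in
degree `≤ m`. -/
lemma hasProjectiveDimensionLE_of_projective_le [EnoughProjectives A] {m : ℕ}
    (h : ∀ P : A, Projective P → HasInjectiveDimensionLE P m) {X : A}
    (hX : projectiveDimension X ≠ ⊤) : HasProjectiveDimensionLE X m := by
  let := HasExt.standard A
  obtain ⟨j, hj⟩ := (projectiveDimension_ne_top_iff X).1 hX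
  have key : ∀ i : ℕ, HasProjectiveDimensionLT X (m + 1 + i) → HasProjectiveDimensionLE X m := by
    intro i
    induction i with
    | zero => exact id
    | succ i ih =>
      intro hi
      refine ih (HasProjectiveDimensionLT.mk fun l hl Y e => ?_)
      let p := Projective.π Y
      have hS : (ShortComplex.mk _ _ (kernel.condition p)).ShortExact :=
        { exact := ShortComplex.exact_kernel p }
      have := h (Projective.over Y) inferInstance
      obtain ⟨y, rfl⟩ := Ext.covariant_sequence_exact₃ X hS e rfl
        (Ext.eq_zero_of_hasProjectiveDimensionLT _ (m + 1 + (i + 1)) (by lia))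
      rw [Ext.eq_zero_of_hasInjectiveDimensionLT y (m + 1) (by lia), Ext.zero_comp]
  have := hasProjectiveDimensionLT_of_ge X (j + 1) (m + 1 + j) (by lia)
  exact key j this

lemma hasInjectiveDimensionLE_of_injective_le [EnoughInjectives A] {m : ℕ}
    (h : ∀ I : A, Injective I → HasProjectiveDimensionLE I m) {X : A}
    (hX : injectiveDimension X ≠ ⊤) : HasInjectiveDimensionLE X m := by
  let := HasExt.standard A
  obtain ⟨j, hj⟩ := (injectiveDimension_ne_top_iff X).1 hX
  have key : ∀ i : ℕ, HasInjectiveDimensionLT X (m + 1 + i) → HasInjectiveDimensionLE X m := by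
    intro i
    induction i with
    | zero => exact id
    | succ i ih =>
      intro hi
      refine ih (HasInjectiveDimensionLT.mk fun l hl Y e => ?_)
      let p := Injective.ι Y
      have hS : (ShortComplex.mk _ _ (cokernel.condition p)).ShortExact :=
        { exact := ShortComplex.exact_cokernel p }
      have := h (Injective.under Y) inferInstance
      obtain ⟨y, rfl⟩ := Ext.contravariant_sequence_exact₁ hS X e (add_comm 1 l)
        (Ext.eq_zero_of_hasInjectiveDimensionLT _ (m + 1 + (i + 1)) (by lia))
      rw [Ext.eq_zero_of_hasProjectiveDimensionLT y (m + 1) (by lia), Ext.comp_zero]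
  have := hasInjectiveDimensionLT_of_ge X (j + 1) (m + 1 + j) (by lia)
  exact key j this

lemma hasInjectiveDimensionLE_of_projectiveDimension_ne_top [EnoughProjectives A] {m : ℕ}
    (h : ∀ P : A, Projective P → HasInjectiveDimensionLE P m) {X : A}
    (hX : projectiveDimension X ≠ ⊤) : HasInjectiveDimensionLE X m := by
  obtain ⟨j, hj⟩ := (projectiveDimension_ne_top_iff X).1 hX
  induction j generalizing X with
  | zero => exact h X (projective_iff_hasProjectiveDimensionLT_one.2 hj)
  | succ j ih =>
    let p := Projective.π X
    have hS : (ShortComplex.mk _ _ (kernel.condition p)).ShortExact :=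
      { exact := ShortComplex.exact_kernel p }
    have hK := hS.hasProjectiveDimensionLT_X₁ (j + 1)
      (hasProjectiveDimensionLT_of_ge (Projective.over X) 1 _ (by lia)) hj
    have := ih ((projectiveDimension_ne_top_iff _).2 ⟨j, hK⟩) hK
    exact hS.hasInjectiveDimensionLT_X₃ (m + 1) (h _ inferInstance)
      (hasInjectiveDimensionLT_of_ge _ (m + 1) _ (by lia))

lemma hasProjectiveDimensionLE_of_injectiveDimension_ne_top [EnoughInjectives A] {m : ℕ}
    (h : ∀ I : A, Injective I → HasProjectiveDimensionLE I m) {X : A}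
    (hX : injectiveDimension X ≠ ⊤) : HasProjectiveDimensionLE X m := by
  obtain ⟨j, hj⟩ := (injectiveDimension_ne_top_iff X).1 hX
  induction j generalizing X with
  | zero => exact h X (injective_iff_hasInjectiveDimensionLT_one.2 hj)
  | succ j ih =>
    let p := Injective.ι X
    have hS : (ShortComplex.mk _ _ (cokernel.condition p)).ShortExact :=
      { exact := ShortComplex.exact_cokernel p }
    have hK := hS.hasInjectiveDimensionLT_X₃ (j + 1)
      (hasInjectiveDimensionLT_of_ge (Injective.under X) 1 _ (by lia)) hj
    have := ih ((injectiveDimension_ne_top_iff _).2 ⟨j, hK⟩) hK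
    exact hS.hasProjectiveDimensionLT_X₁ (m + 1) (h _ inferInstance)
      (hasProjectiveDimensionLT_of_ge _ (m + 1) _ (by lia))

lemma projectiveDimension_ne_top_of_projective (P : A) [Projective P] :
    projectiveDimension P ≠ ⊤ :=
  (projectiveDimension_ne_top_iff P).2 ⟨0, inferInstance⟩

lemma injectiveDimension_ne_top_of_injective (I : A) [Injective I] :
    injectiveDimension I ≠ ⊤ :=
  (injectiveDimension_ne_top_iff I).2 ⟨0, inferInstance⟩

namespace IsNGorensteinCategory

variable {n : ℕ}

lemma injectiveDimension_le (h : IsNGorensteinCategory A n) (P : A) [Projective P] :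
    HasInjectiveDimensionLE P n :=
  (finitaryInjectiveDimension_le_iff n).1 h.finitaryInjectiveDimension_eq.le P
    ((h.isGorenstein.finite_iff P).1 (projectiveDimension_ne_top_of_projective P))

lemma projectiveDimension_le (h : IsNGorensteinCategory A n) (I : A) [Injective I] :
    HasProjectiveDimensionLE I n :=
  (finitaryProjectiveDimension_le_iff n).1 h.finitaryProjectiveDimension_eq.le I
    ((h.isGorenstein.finite_iff I).2 (injectiveDimension_ne_top_of_injective I))

/-- The Gorenstein dimension is the least bound on the injective dimensions of projectives. -/
lemma le_of_projective_le [EnoughProjectives A] (h : IsNGorensteinCategory A n) {m : ℕ}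
    (hm : ∀ P : A, Projective P → HasInjectiveDimensionLE P m) : n ≤ m := by
  have := (finitaryProjectiveDimension_le_iff (A := A) m).2
    fun X hX => hasProjectiveDimensionLE_of_projective_le hm hX
  rw [h.finitaryProjectiveDimension_eq] at this
  exact_mod_cast this

end IsNGorensteinCategory

/-- A Grothendieck category with a projective separator in which projectives have injective
dimension `≤ n` and injectives have projective dimension `≤ n` is Gorenstein, of dimension `≤ n`. -/
theorem exists_isNGorensteinCategory [IsGrothendieckAbelian.{v} A] [EnoughProjectives A] {n : ℕ}
    (hG : ∃ G : A, IsSeparator G ∧ Projective G)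
    (hP : ∀ P : A, Projective P → HasInjectiveDimensionLE P n)
    (hI : ∀ I : A, Injective I → HasProjectiveDimensionLE I n) :
    ∃ n' ≤ n, IsNGorensteinCategory A n' := by
  have hfp : finitaryProjectiveDimension A ≤ n :=
    (finitaryProjectiveDimension_le_iff n).2
      fun X hX => hasProjectiveDimensionLE_of_projective_le hP hX
  have hfi : finitaryInjectiveDimension A ≤ n :=
    (finitaryInjectiveDimension_le_iff n).2
      fun X hX => hasInjectiveDimensionLE_of_injective_le hI hX
  have finite_iff (X : A) : projectiveDimension X ≠ ⊤ ↔ injectiveDimension X ≠ ⊤ :=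
    ⟨fun hX => (injectiveDimension_ne_top_iff X).2
      ⟨n, hasInjectiveDimensionLE_of_projectiveDimension_ne_top hP hX⟩,
     fun hX => (projectiveDimension_ne_top_iff X).2
      ⟨n, hasProjectiveDimensionLE_of_injectiveDimension_ne_top hI hX⟩⟩
  obtain ⟨p, hp⟩ := ENat.ne_top_iff_exists.1 (ne_top_of_le_ne_top (ENat.natCast_ne_top n) hfp)
  obtain ⟨i, hi⟩ := ENat.ne_top_iff_exists.1 (ne_top_of_le_ne_top (ENat.natCast_ne_top n) hfi)
  have hpi : p ≤ i := by
    have := (finitaryProjectiveDimension_le_iff (A := A) i).2 fun X hX =>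
      hasProjectiveDimensionLE_of_projective_le (fun P _ =>
        (finitaryInjectiveDimension_le_iff i).1 hi.ge P
          ((finite_iff P).1 (projectiveDimension_ne_top_of_projective P))) hX
    rw [← hp] at this
    exact_mod_cast this
  have hip : i ≤ p := by
    have := (finitaryInjectiveDimension_le_iff (A := A) p).2 fun X hX =>
      hasInjectiveDimensionLE_of_injective_le (fun I _ =>
        (finitaryProjectiveDimension_le_iff p).1 hp.ge I
          ((finite_iff I).2 (injectiveDimension_ne_top_of_injective I))) hX
    rw [← hi] at this
    exact_mod_cast this
  obtain rfl := le_antisymm hpi hip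
  refine ⟨p, ?_, ⟨inferInstance, finite_iff, ?_, ?_, ?_⟩, hp.symm, hi.symm⟩
  · rw [← hp] at hfp
    exact_mod_cast hfp
  · rw [← hp]
    exact ENat.natCast_ne_top p
  · rw [← hi]
    exact ENat.natCast_ne_top p
  · obtain ⟨G, hG, hG'⟩ := hG
    exact ⟨G, hG, projectiveDimension_ne_top_of_projective G⟩

end HomologicalDimension

namespace RightMod

/-! ### Limits, colimits and exactness in categories of right modules -/

section

variable {k : Type u} [CommRing k] {D : Type u} [Category.{u} D] [Preadditive D] [Linear k D]

instance isClosedUnderColimitsOfShape (J : Type v) [Category.{w} J]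
    [HasColimitsOfShape J (ModuleCat.{u} k)] :
    (isLinearPresheaf k D).IsClosedUnderColimitsOfShape J := by
  refine ⟨?_⟩
  rintro X ⟨p⟩
  refine ⟨fun c d f g => ?_, fun c d r f => ?_⟩
  · refine (isColimitOfPreserves ((evaluation _ _).obj (Opposite.op d)) p.isColimit).hom_ext ?_
    intro j
    simp [-op_add, ← NatTrans.naturality, (p.prop_diag_obj j).1]
  · refine (isColimitOfPreserves ((evaluation _ _).obj (Opposite.op d)) p.isColimit).hom_ext ?_
    intro j
    simp [← NatTrans.naturality, (p.prop_diag_obj j).2]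

instance isClosedUnderLimitsOfShape (J : Type v) [Category.{w} J]
    [HasLimitsOfShape J (ModuleCat.{u} k)] :
    (isLinearPresheaf k D).IsClosedUnderLimitsOfShape J := by
  refine ⟨?_⟩
  rintro X ⟨p⟩
  refine ⟨fun c d f g => ?_, fun c d r f => ?_⟩
  · refine (isLimitOfPreserves ((evaluation _ _).obj (Opposite.op c)) p.isLimit).hom_ext ?_
    intro j
    simp [-op_add, (p.prop_diag_obj j).1]
  · refine (isLimitOfPreserves ((evaluation _ _).obj (Opposite.op c)) p.isLimit).hom_ext ?_
    intro j
    simp [(p.prop_diag_obj j).2]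

instance : PreservesFiniteLimits (isLinearPresheaf k D).ι where
  preservesFiniteLimits _ := inferInstance

instance : PreservesFiniteColimits (isLinearPresheaf k D).ι where
  preservesFiniteColimits _ := inferInstance

instance : (isLinearPresheaf k D).ι.Additive where

variable (k D) in
/-- Filtered colimits of right modules are computed pointwise, hence exact. -/
lemma isGrothendieckAbelian_of_hasSeparator [HasSeparator (RightMod k D)] :
    IsGrothendieckAbelian.{u} (RightMod k D) where
  hasFilteredColimitsOfSize := ⟨fun _ _ _ => inferInstance⟩
  ab5OfSize :=
    have : HasFilteredColimitsOfSize.{u, u} (RightMod k D) := ⟨fun _ _ _ => inferInstance⟩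
    ⟨fun J _ _ => HasExactColimitsOfShape.domain_of_functor J (isLinearPresheaf k D).ι⟩

/-- Evaluation of right modules at an object. -/
abbrev eval (d : D) : RightMod k D ⥤ ModuleCat.{u} k :=
  (isLinearPresheaf k D).ι ⋙ (evaluation _ _).obj (Opposite.op d)

instance (d : D) : PreservesFiniteLimits (eval (k := k) d) := comp_preservesFiniteLimits _ _

instance (d : D) : PreservesFiniteColimits (eval (k := k) d) := comp_preservesFiniteColimits _ _

lemma mono_of_injective {M N : RightMod k D} (f : M ⟶ N)
    (h : ∀ d, Function.Injective ((eval d).map f)) : Mono f := by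
  have (X : Dᵒᵖ) : Mono (((isLinearPresheaf k D).ι.map f).app X) :=
    (ModuleCat.mono_iff_injective _).2 (h X.unop)
  have := NatTrans.mono_of_mono_app ((isLinearPresheaf k D).ι.map f)
  exact (isLinearPresheaf k D).ι.mono_of_mono_map this

lemma epi_of_surjective {M N : RightMod k D} (f : M ⟶ N)
    (h : ∀ d, Function.Surjective ((eval d).map f)) : Epi f := by
  have (X : Dᵒᵖ) : Epi (((isLinearPresheaf k D).ι.map f).app X) :=
    (ModuleCat.epi_iff_surjective _).2 (h X.unop)
  have := NatTrans.epi_of_epi_app ((isLinearPresheaf k D).ι.map f)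
  exact (isLinearPresheaf k D).ι.epi_of_epi_map this

lemma injective_of_mono {M N : RightMod k D} (f : M ⟶ N) [Mono f] (d : D) :
    Function.Injective ((eval d).map f) :=
  (ModuleCat.mono_iff_injective _).1 inferInstance

lemma surjective_of_epi {M N : RightMod k D} (f : M ⟶ N) [Epi f] (d : D) :
    Function.Surjective ((eval d).map f) :=
  (ModuleCat.epi_iff_surjective _).1 inferInstance

/-- Exactness of a sequence of right modules is tested pointwise. -/
lemma shortExact_of_eval {S : ShortComplex (RightMod k D)}
    (h : ∀ d, (S.map (eval d)).ShortExact) : S.ShortExact where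
  exact := by
    rw [ShortComplex.exact_iff_isZero_homology, IsZero.iff_id_eq_zero]
    apply (isLinearPresheaf k D).ι.map_injective
    ext X : 2
    have := (S.map (eval X.unop)).exact_iff_isZero_homology.1 (h X.unop).exact
    exact (this.of_iso (S.mapHomologyIso (eval X.unop)).symm).eq_of_src _ _
  mono_f := mono_of_injective _ fun d => (ModuleCat.mono_iff_injective _).1 (h d).mono_f
  epi_g := epi_of_surjective _ fun d => (ModuleCat.epi_iff_surjective _).1 (h d).epi_g

end

end RightMod

namespace ScalarExt

/-! ### Modules over `R ⊗ C` as systems of right `R`-modules -/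

variable {k R C : Type u} [CommRing k] [Ring R] [Algebra k R]
  [Category.{u} C] [Preadditive C] [Linear k C]

/-- The pure tensor `r ⊗ f` as a morphism of `R ⊗ C`. -/
noncomputable def tmul (k : Type u) {R C : Type u} [CommRing k] [Ring R] [Algebra k R]
    [Category.{u} C] [Preadditive C] [Linear k C] {c d : C} (r : R) (f : c ⟶ d) :
    (⟨c⟩ : ScalarExt k R C) ⟶ ⟨d⟩ :=
  r ⊗ₜ[k] f

lemma tmul_comp_tmul {c d e : C} (r s : R) (f : c ⟶ d) (g : d ⟶ e) :
    tmul k r f ≫ tmul k s g = tmul k (s * r) (f ≫ g) :=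
  compMap_tmul r s f g

lemma tmul_one_id (c : C) : tmul k (1 : R) (𝟙 c) = 𝟙 (⟨c⟩ : ScalarExt k R C) := rfl

lemma add_tmul {c d : C} (r s : R) (f : c ⟶ d) : tmul k (r + s) f = tmul k r f + tmul k s f :=
  TensorProduct.add_tmul r s f

lemma tmul_add {c d : C} (r : R) (f g : c ⟶ d) : tmul k r (f + g) = tmul k r f + tmul k r g :=
  TensorProduct.tmul_add r f g

lemma tmul_smul {c d : C} (a : k) (r : R) (f : c ⟶ d) :
    tmul k r (a • f) = tmul k (algebraMap k R a * r) f := by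
  rw [← Algebra.smul_def]
  exact TensorProduct.tmul_smul a r f

lemma smul_tmul {c d : C} (a : k) (r : R) (f : c ⟶ d) :
    tmul k (a • r) f = a • tmul k r f := rfl

@[elab_as_elim]
lemma hom_induction {c d : C} {p : ((⟨c⟩ : ScalarExt k R C) ⟶ ⟨d⟩) → Prop} (h0 : p 0)
    (ht : ∀ r f, p (tmul k r f)) (ha : ∀ x y, p x → p y → p (x + y)) (x) : p x :=
  TensorProduct.induction_on x h0 ht ha

end ScalarExt

namespace RightMod

open ScalarExt Opposite

variable {k R C : Type u} [CommRing k] [Ring R] [Algebra k R]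
  [Category.{u} C] [Preadditive C] [Linear k C]

section

variable (M N : RightMod k (ScalarExt k R C))

/-- The action of a morphism of `R ⊗ C` on a right module. -/
noncomputable def mapHom {x y : ScalarExt k R C} (f : x ⟶ y) :
    M.obj.obj (op y) →ₗ[k] M.obj.obj (op x) :=
  (M.obj.map f.op).hom

lemma mapHom_comp {x y z : ScalarExt k R C} (f : x ⟶ y) (g : y ⟶ z) (m : M.obj.obj (op z)) :
    M.mapHom (f ≫ g) m = M.mapHom f (M.mapHom g m) := by
  simp [mapHom]

lemma mapHom_id (x : ScalarExt k R C) (m : M.obj.obj (op x)) : M.mapHom (𝟙 x) m = m := by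
  simp [mapHom]

lemma mapHom_add {x y : ScalarExt k R C} (f g : x ⟶ y) :
    M.mapHom (f + g) = M.mapHom f + M.mapHom g := by
  simp [mapHom, -op_add, M.property.1]

lemma mapHom_smul {x y : ScalarExt k R C} (a : k) (f : x ⟶ y) :
    M.mapHom (a • f) = a • M.mapHom f := by
  simp [mapHom, M.property.2]

lemma mapHom_zero {x y : ScalarExt k R C} :
    M.mapHom (0 : x ⟶ y) = 0 := by
  simpa using M.mapHom_smul (0 : k) (0 : x ⟶ y)

/-- The value at `c` of a right module over `R ⊗ C`, as a right `R`-module: `r` acts through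
`r ⊗ 1`. -/
noncomputable abbrev valueModule (c : C) : Module Rᵐᵒᵖ (M.obj.obj (op ⟨c⟩)) where
  smul s m := M.mapHom (tmul k s.unop (𝟙 c)) m
  one_smul m := M.mapHom_id _ m
  mul_smul s t m := by
    change M.mapHom _ m = M.mapHom _ (M.mapHom _ m)
    rw [← mapHom_comp, tmul_comp_tmul, Category.comp_id, MulOpposite.unop_mul]
  smul_zero s := map_zero _
  smul_add s m m' := map_add _ m m'
  add_smul s t m := by
    change M.mapHom _ m = M.mapHom _ m + M.mapHom _ m
    rw [MulOpposite.unop_add, add_tmul, mapHom_add, LinearMap.add_apply]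
  zero_smul m := by
    change M.mapHom _ m = 0
    rw [MulOpposite.unop_zero, ← zero_smul k (0 : R), smul_tmul, zero_smul, mapHom_zero,
      LinearMap.zero_apply]

/-- Evaluation at `c`, as a functor to right `R`-modules. -/
noncomputable def value (c : C) : RightMod k (ScalarExt k R C) ⥤ ModuleCat.{u} Rᵐᵒᵖ where
  obj M := letI := valueModule M c; ModuleCat.of Rᵐᵒᵖ (M.obj.obj (op ⟨c⟩))
  map {M N} φ :=
    letI := valueModule M c
    letI := valueModule N c
    ModuleCat.ofHom
      { toFun := (φ.hom.app (op ⟨c⟩)).hom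
        map_add' := map_add _
        map_smul' s m := ConcreteCategory.congr_hom
          (φ.hom.naturality (tmul k s.unop (𝟙 c)).op) m }

/-- The action of a morphism of `R ⊗ C` on the values of a right module. -/
noncomputable def act {c d : C} (z : (⟨c⟩ : ScalarExt k R C) ⟶ ⟨d⟩) :
    (value d).obj M →+ (value c).obj M :=
  (M.mapHom z).toAddMonoidHom

lemma act_comp {c d e : C} (x : (⟨c⟩ : ScalarExt k R C) ⟶ ⟨d⟩) (y : (⟨d⟩ : ScalarExt k R C) ⟶ ⟨e⟩)
    (m : (value e).obj M) : M.act (x ≫ y) m = M.act x (M.act y m) :=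
  M.mapHom_comp x y m

lemma act_id (c : C) (m : (value c).obj M) : M.act (𝟙 (⟨c⟩ : ScalarExt k R C)) m = m :=
  M.mapHom_id _ m

lemma act_add {c d : C} (x y : (⟨c⟩ : ScalarExt k R C) ⟶ ⟨d⟩) (m : (value d).obj M) :
    M.act (x + y) m = M.act x m + M.act y m :=
  LinearMap.congr_fun (M.mapHom_add x y) m

lemma act_zero {c d : C} (m : (value d).obj M) :
    M.act (0 : (⟨c⟩ : ScalarExt k R C) ⟶ ⟨d⟩) m = 0 :=
  LinearMap.congr_fun M.mapHom_zero m

lemma smul_eq_act {c : C} (s : Rᵐᵒᵖ) (m : (value c).obj M) :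
    s • m = M.act (tmul k s.unop (𝟙 c)) m := rfl

/-- The action of a morphism of `C` on the values of a right module over `R ⊗ C`. -/
noncomputable def restr {c d : C} (f : c ⟶ d) :
    (value d).obj M →ₗ[Rᵐᵒᵖ] (value c).obj M where
  toFun := M.act (tmul k (1 : R) f)
  map_add' := map_add _
  map_smul' s m := by
    simp only [smul_eq_act, ← act_comp, tmul_comp_tmul]
    simp

lemma restr_apply {c d : C} (f : c ⟶ d) (m : (value d).obj M) :
    M.restr f m = M.act (tmul k (1 : R) f) m := rfl

lemma act_tmul {c d : C} (r : R) (f : c ⟶ d) (m : (value d).obj M) :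
    M.act (tmul k r f) m = MulOpposite.op r • M.restr f m := by
  simp only [smul_eq_act, restr_apply, ← act_comp, tmul_comp_tmul]
  simp

lemma restr_comp {c d e : C} (f : c ⟶ d) (g : d ⟶ e) (m : (value e).obj M) :
    M.restr (f ≫ g) m = M.restr f (M.restr g m) := by
  simp only [restr_apply, ← act_comp, tmul_comp_tmul, mul_one]

lemma restr_id (c : C) (m : (value c).obj M) : M.restr (𝟙 c) m = m :=
  M.act_id c m

lemma restr_add {c d : C} (f g : c ⟶ d) (m : (value d).obj M) :
    M.restr (f + g) m = M.restr f m + M.restr g m := by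
  simp only [restr_apply, tmul_add, act_add]

lemma restr_smul {c d : C} (a : k) (f : c ⟶ d) (m : (value d).obj M) :
    M.restr (a • f) m = algebraMap k Rᵐᵒᵖ a • M.restr f m := by
  rw [restr_apply, tmul_smul, act_tmul, mul_one]
  rfl

/-- `restr` as a homomorphism of additive groups in the morphism. -/
noncomputable def restrHom {c d : C} (m : (value d).obj M) : (c ⟶ d) →+ (value c).obj M :=
  AddMonoidHom.mk' (fun f => M.restr f m) fun f g => M.restr_add f g m

lemma restr_sum {ι : Type*} (s : Finset ι) {c d : C} (f : ι → (c ⟶ d)) (m : (value d).obj M) :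
    M.restr (∑ j ∈ s, f j) m = ∑ j ∈ s, M.restr (f j) m :=
  map_sum (M.restrHom m) f s

lemma smul_eq_mapHom {c : C} (a : k) (m : M.obj.obj (op ⟨c⟩)) :
    a • m = M.mapHom (tmul k (algebraMap k R a) (𝟙 c)) m := by
  rw [Algebra.algebraMap_eq_smul_one, smul_tmul, mapHom_smul, tmul_one_id, LinearMap.smul_apply,
    mapHom_id]

variable {M N}

lemma map_restr (φ : M ⟶ N) {c d : C} (f : c ⟶ d) (m : (value d).obj M) :
    ((value c).map φ).hom (M.restr f m) = N.restr f (((value d).map φ).hom m) :=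
  ConcreteCategory.congr_hom (φ.hom.naturality (tmul k (1 : R) f).op) m

lemma hom_ext {φ ψ : M ⟶ N}
    (h : ∀ (c : C) (m : (value c).obj M), ((value c).map φ).hom m = ((value c).map ψ).hom m) :
    φ = ψ := by
  apply (isLinearPresheaf k _).ι.map_injective
  ext X m
  exact h X.unop.obj m

/-- Right `R`-linear maps on values that commute with the action of `C` form a morphism of right
modules. -/
noncomputable def homMk (φ : ∀ c : C, (value c).obj M →ₗ[Rᵐᵒᵖ] (value c).obj N)
    (h : ∀ (c d : C) (f : c ⟶ d) (m : (value d).obj M),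
      φ c (M.restr f m) = N.restr f (φ d m)) : M ⟶ N :=
  (isLinearPresheaf k _).homMk
    { app X := ModuleCat.ofHom
        { toFun := φ X.unop.obj
          map_add' := map_add (φ X.unop.obj)
          map_smul' a m := (congrArg (φ _) (smul_eq_mapHom M a m)).trans
            (((φ X.unop.obj).map_smul (algebraMap k Rᵐᵒᵖ a) m).trans (smul_eq_mapHom N a _).symm) }
      naturality := by
        have key (c d : C) (z : (⟨c⟩ : ScalarExt k R C) ⟶ ⟨d⟩) (m : (value d).obj M) :
            φ c (M.act z m) = N.act z (φ d m) := by
          induction z using hom_induction with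
          | h0 => simp [act_zero]
          | ha x y hx hy => rw [act_add, act_add, map_add, hx, hy]
          | ht r f => rw [act_tmul, act_tmul, map_smul, h]
        rintro ⟨⟨d⟩⟩ ⟨⟨c⟩⟩ ⟨f⟩
        ext m
        exact key c d f m }

@[simp]
lemma value_map_homMk (φ : ∀ c : C, (value c).obj M →ₗ[Rᵐᵒᵖ] (value c).obj N)
    (h : ∀ (c d : C) (f : c ⟶ d) (m : (value d).obj M),
      φ c (M.restr f m) = N.restr f (φ d m)) (c : C) :
    ((value c).map (homMk φ h)).hom = φ c := rfl

end

section Systems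

/-- The data of right `R`-modules `V c` with a `k`-linear contravariant action of `C`. -/
structure System (k R C : Type u) [CommRing k] [Ring R] [Algebra k R]
    [Category.{u} C] [Preadditive C] [Linear k C] where
  V : C → Type u
  [grp (c : C) : AddCommGroup (V c)]
  [mod (c : C) : Module Rᵐᵒᵖ (V c)]
  act {c d : C} (f : c ⟶ d) : V d →ₗ[Rᵐᵒᵖ] V c
  act_id (c : C) (v : V c) : act (𝟙 c) v = v
  act_comp {c d e : C} (f : c ⟶ d) (g : d ⟶ e) (v : V e) : act (f ≫ g) v = act f (act g v)
  act_add {c d : C} (f g : c ⟶ d) (v : V d) : act (f + g) v = act f v + act g v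
  act_smul {c d : C} (a : k) (f : c ⟶ d) (v : V d) :
    act (a • f) v = algebraMap k Rᵐᵒᵖ a • act f v

namespace System

attribute [instance] System.grp System.mod

variable (F : System k R C)

/-- The `k`-module structure of the values. -/
noncomputable abbrev modK (c : C) : Module k (F.V c) := Module.compHom _ (algebraMap k Rᵐᵒᵖ)

attribute [local instance] modK

instance (c : C) : IsScalarTower k Rᵐᵒᵖ (F.V c) := IsScalarTower.of_algebraMap_smul fun _ _ => rfl

instance (c : C) : SMulCommClass Rᵐᵒᵖ k (F.V c) := IsScalarTower.to_smulCommClass'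

/-- The action of all of `R ⊗ Hom(c, d)`: `r ⊗ f` acts as `f` followed by `r`. -/
noncomputable def actTensor (c d : C) : R ⊗[k] (c ⟶ d) →ₗ[k] (F.V d →ₗ[k] F.V c) :=
  TensorProduct.lift <| LinearMap.mk₂ k
    (fun r f => (Module.toModuleEnd k (S := Rᵐᵒᵖ) (F.V c) (MulOpposite.op r)) ∘ₗ
      (F.act f).restrictScalars k)
    (fun r s f => by
      ext v
      simp [add_smul])
    (fun a r f => by
      ext v
      simp)
    (fun r f g => by
      ext v
      simp [F.act_add])
    (fun a r f => by
      ext v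
      simp only [LinearMap.comp_apply, LinearMap.coe_restrictScalars, F.act_smul,
        LinearMap.smul_apply]
      exact smul_comm (MulOpposite.op r) a (F.act f v))

lemma actTensor_tmul {c d : C} (r : R) (f : c ⟶ d) (v : F.V d) :
    F.actTensor c d (r ⊗ₜ[k] f) v = MulOpposite.op r • F.act f v := by
  simp [actTensor]

lemma actTensor_comp {c d e : C} (x : R ⊗[k] (c ⟶ d)) (y : R ⊗[k] (d ⟶ e)) (v : F.V e) :
    F.actTensor c e (compMap k R C c d e x y) v = F.actTensor c d x (F.actTensor d e y v) := by
  induction x using TensorProduct.induction_on with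
  | zero => simp
  | add x x' hx hx' => simp [hx, hx']
  | tmul r f =>
    induction y using TensorProduct.induction_on with
    | zero => simp
    | add y y' hy hy' => simp [hy, hy']
    | tmul s g => simp [compMap_tmul, actTensor_tmul, F.act_comp, mul_smul]

/-- The right module over `R ⊗ C` given by a system of right `R`-modules. -/
noncomputable def toRightMod : RightMod k (ScalarExt k R C) where
  obj :=
    { obj X := ModuleCat.of k (F.V X.unop.obj)
      map {X Y} f := ModuleCat.ofHom (F.actTensor Y.unop.obj X.unop.obj f.unop)
      map_id X := by
        ext v
        exact (F.actTensor_tmul 1 (𝟙 X.unop.obj) v).trans (by simp [F.act_id])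
      map_comp f g := by
        ext v
        exact F.actTensor_comp g.unop f.unop v }
  property := by
    refine ⟨fun c d f g => ?_, fun c d r f => ?_⟩
    · ext v
      exact LinearMap.congr_fun (map_add (F.actTensor c.obj d.obj) f g) v
    · ext v
      exact LinearMap.congr_fun (map_smul (F.actTensor c.obj d.obj) r f) v

/-- The values of `F.toRightMod` are the modules of the system. -/
noncomputable def valueEquiv (c : C) : (value c).obj F.toRightMod ≃ₗ[Rᵐᵒᵖ] F.V c where
  toFun v := v
  invFun v := v
  map_add' _ _ := rfl
  map_smul' s v := (F.actTensor_tmul s.unop (𝟙 c) v).trans (congrArg (s • ·) (F.act_id c v))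
  left_inv _ := rfl
  right_inv _ := rfl

lemma valueEquiv_restr {c d : C} (f : c ⟶ d) (v : (value d).obj F.toRightMod) :
    F.valueEquiv c (F.toRightMod.restr f v) = F.act f (F.valueEquiv d v) :=
  (F.actTensor_tmul 1 f v).trans (one_smul _ _)

end System

end Systems

end RightMod

namespace RightMod

open ScalarExt Opposite

section Coind

variable {k R C : Type u} [CommRing k] [Ring R] [Algebra k R]
  [Category.{u} C] [Preadditive C] [Linear k C]

/-! ### Coinduced modules -/

section

variable (k) (X : ModuleCat.{u} Rᵐᵒᵖ)

/-- Restriction of scalars along `k → R`. -/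
noncomputable abbrev restrictModule : Module k X := Module.compHom X (algebraMap k Rᵐᵒᵖ)

attribute [local instance] restrictModule

lemma restrictModule_smul_def (a : k) (x : X) : a • x = algebraMap k Rᵐᵒᵖ a • x := rfl

instance isScalarTower_restrictModule : IsScalarTower k Rᵐᵒᵖ X :=
  IsScalarTower.of_algebraMap_smul fun _ _ => rfl

instance smulCommClass_restrictModule : SMulCommClass Rᵐᵒᵖ k X := IsScalarTower.to_smulCommClass'

end

attribute [local instance] restrictModule

variable {I : Type u} (a : I → C) (X Y : I → ModuleCat.{u} Rᵐᵒᵖ)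

/-- The system `c ↦ ∏ i, Hom_k(Hom(a i, c), X i)`. -/
noncomputable def coindSystem : System k R C where
  V c := ∀ i, (a i ⟶ c) →ₗ[k] X i
  act {c d} f := LinearMap.pi fun i =>
    { toFun u := u i ∘ₗ Linear.rightComp k (a i) f
      map_add' _ _ := rfl
      map_smul' _ _ := rfl }
  act_id c v := by
    ext i f
    simp
  act_comp f g v := by
    ext i h
    simp
  act_add f g v := by
    ext i h
    simp
  act_smul r f v := by
    ext i h
    simp [restrictModule_smul_def]

/-- The right module `c ↦ ∏ i, Hom_k(Hom(a i, c), X i)`, coinduced from the right `R`-modules `X i`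
placed at the objects `a i`. -/
noncomputable def coind : RightMod k (ScalarExt k R C) := (coindSystem (k := k) a X).toRightMod

/-- Elements of a coinduced module as families of linear maps. -/
noncomputable def coindEquiv (c : C) :
    (value c).obj (coind (k := k) a X) ≃ₗ[Rᵐᵒᵖ] ∀ i, (a i ⟶ c) →ₗ[k] X i :=
  (coindSystem (k := k) a X).valueEquiv c

variable {a X Y}

lemma coindEquiv_restr {c d : C} (f : c ⟶ d) (u : (value d).obj (coind (k := k) a X)) (i : I)
    (h : a i ⟶ c) :
    coindEquiv a X c ((coind a X).restr f u) i h = coindEquiv a X d u i (h ≫ f) :=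
  LinearMap.congr_fun (congrFun ((coindSystem (k := k) a X).valueEquiv_restr f u) i) h

lemma coind_ext {c : C} {u v : (value c).obj (coind (k := k) a X)}
    (h : ∀ i (f : a i ⟶ c), coindEquiv a X c u i f = coindEquiv a X c v i f) : u = v :=
  (coindEquiv a X c).injective (funext fun i => LinearMap.ext (h i))

/-- A homomorphism of right `R`-modules is `k`-linear. -/
abbrev homK {V W : ModuleCat.{u} Rᵐᵒᵖ} (φ : V ⟶ W) : V →ₗ[k] W where
  toFun := φ.hom
  map_add' := map_add φ.hom
  map_smul' r := φ.hom.map_smul (algebraMap k Rᵐᵒᵖ r)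

/-- Functoriality of coinduction. -/
noncomputable def coindMap (φ : ∀ i, X i ⟶ Y i) : coind (k := k) a X ⟶ coind a Y :=
  homMk (fun c => (coindEquiv a Y c).symm.toLinearMap ∘ₗ
      (LinearMap.pi fun i =>
        { toFun u := homK (φ i) ∘ₗ u i
          map_add' u v := by
            ext f
            simp
          map_smul' s u := by
            ext f
            simp } : (∀ i, (a i ⟶ c) →ₗ[k] X i) →ₗ[Rᵐᵒᵖ] ∀ i, (a i ⟶ c) →ₗ[k] Y i) ∘ₗ
      (coindEquiv a X c).toLinearMap)
    fun c d f u => coind_ext fun i h => by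
      rw [coindEquiv_restr]
      simp [coindEquiv_restr]

lemma coindEquiv_coindMap (φ : ∀ i, X i ⟶ Y i) {c : C} (u : (value c).obj (coind (k := k) a X))
    (i : I) (f : a i ⟶ c) :
    coindEquiv a Y c (((value c).map (coindMap φ)).hom u) i f =
      (φ i).hom (coindEquiv a X c u i f) := by
  simp [coindMap]

lemma shortExact_of_value {S : ShortComplex (RightMod k (ScalarExt k R C))}
    (hi : ∀ c : C, Function.Injective ((value c).map S.f).hom)
    (he : ∀ c : C, Function.Exact ((value c).map S.f).hom ((value c).map S.g).hom)
    (hs : ∀ c : C, Function.Surjective ((value c).map S.g).hom) : S.ShortExact :=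
  shortExact_of_eval fun d =>
    { exact := (ShortComplex.ShortExact.moduleCat_exact_iff_function_exact _).2 (he d.obj)
      mono_f := (ModuleCat.mono_iff_injective _).2 (hi d.obj)
      epi_g := (ModuleCat.epi_iff_surjective _).2 (hs d.obj) }

lemma coindMap_comp_eq_zero (S : I → ShortComplex (ModuleCat.{u} Rᵐᵒᵖ)) :
    coindMap (k := k) (a := a) (fun i => (S i).f) ≫ coindMap (fun i => (S i).g) = 0 := by
  apply hom_ext
  intro c m
  rw [Functor.map_comp]
  refine coind_ext fun i f => ?_
  rw [ModuleCat.hom_comp, LinearMap.comp_apply, coindEquiv_coindMap, coindEquiv_coindMap]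
  have := (S i).moduleCat_zero_apply (coindEquiv a (fun i => (S i).X₁) c m i f)
  exact this

/-- Coinduction is exact, as the modules `Hom(a i, c)` are projective. -/
lemma shortExact_coindMap (hfinite : IsHomFinite k C)
    (S : I → ShortComplex (ModuleCat.{u} Rᵐᵒᵖ)) (hS : ∀ i, (S i).ShortExact) :
    (ShortComplex.mk (coindMap (k := k) (a := a) fun i => (S i).f) (coindMap fun i => (S i).g)
      (coindMap_comp_eq_zero S)).ShortExact := by
  apply shortExact_of_value
  · intro c u v h
    refine coind_ext fun i f => (ModuleCat.mono_iff_injective _).1 (hS i).mono_f ?_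
    have := congrArg (fun w => coindEquiv a _ c w i f) h
    simpa only [coindEquiv_coindMap] using this
  · intro c v
    refine ⟨fun hv => ?_, ?_⟩
    · have hv' (i : I) (f : a i ⟶ c) : ∃ x, (S i).f.hom x = coindEquiv a _ c v i f := by
        refine ((ShortComplex.ShortExact.moduleCat_exact_iff_function_exact _).1
          (hS i).exact _).1 ?_
        have := congrArg (fun w => coindEquiv a _ c w i f) hv
        simp only [coindEquiv_coindMap] at this
        exact this.trans (by simp)
      have hinj (i : I) : Function.Injective (homK (k := k) (S i).f) :=
        (ModuleCat.mono_iff_injective _).1 (hS i).mono_f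
      have hlift (i : I) : ∃ u : (a i ⟶ c) →ₗ[k] (S i).X₁,
          homK (S i).f ∘ₗ u = coindEquiv a _ c v i := by
        have hr (f : a i ⟶ c) : coindEquiv a _ c v i f ∈ LinearMap.range (homK (k := k) (S i).f) :=
          hv' i f
        refine ⟨(LinearEquiv.ofInjective _ (hinj i)).symm.toLinearMap ∘ₗ
          (coindEquiv a _ c v i).codRestrict _ hr, ?_⟩
        ext f
        exact congrArg Subtype.val ((LinearEquiv.ofInjective _ (hinj i)).apply_symm_apply
          ⟨_, hr f⟩)
      choose u hu using hlift
      refine ⟨(coindEquiv a _ c).symm u, coind_ext fun i f => ?_⟩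
      rw [coindEquiv_coindMap, LinearEquiv.apply_symm_apply, ← hu]
      rfl
    · rintro ⟨u, rfl⟩
      have := congrArg (fun φ => ((value c).map φ).hom u)
        (coindMap_comp_eq_zero (k := k) (a := a) S)
      exact this
  · intro c v
    have hlift (i : I) : ∃ u : (a i ⟶ c) →ₗ[k] (S i).X₂,
        homK (S i).g ∘ₗ u = coindEquiv a _ c v i := by
      have := (hfinite (a i) c).2
      exact Module.projective_lifting_property _ _ ((ModuleCat.epi_iff_surjective _).1 (hS i).epi_g)
    choose u hu using hlift
    refine ⟨(coindEquiv a _ c).symm u, coind_ext fun i f => ?_⟩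
    rw [coindEquiv_coindMap, LinearEquiv.apply_symm_apply, ← hu]
    rfl

end Coind

end RightMod

section DualBases

variable {k C : Type u} [CommRing k] [Category.{u} C] [Preadditive C] [Linear k C]

/-! ### Dual bases from a Serre functor -/

/-- Dual bases of `Hom(a, d)` and `Hom(d, b)` for the pairing `(h, g) ↦ τ (h ≫ g)`. -/
structure DualBases {a b : C} (τ : (a ⟶ b) →ₗ[k] k) (d : C) where
  m : ℕ
  left : Fin m → (a ⟶ d)
  right : Fin m → (d ⟶ b)
  sum_left (h : a ⟶ d) : ∑ j, τ (h ≫ right j) • left j = h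
  sum_right (g : d ⟶ b) : ∑ j, τ (left j ≫ g) • right j = g

/-- The Serre isomorphism `Hom(c, d) ≅ Hom(d, S c)^*` is induced by the trace
`τ = σ (𝟙 c) : Hom(c, S c) → k`, and it turns a dual basis of `Hom(d, S c)` into dual bases for the
pairing. -/
lemma SerreFunctor.nonempty_dualBases (hfinite : IsHomFinite k C) (serre : SerreFunctor k C)
    (c d : C) : Nonempty (DualBases (serre.σ c c (𝟙 c)) d) := by
  have hσ (h : c ⟶ d) (g : d ⟶ serre.S.functor.obj c) :
      serre.σ c d h g = serre.σ c c (𝟙 c) (h ≫ g) := by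
    simpa using serre.naturality_right (𝟙 c) h g
  have := (hfinite d (serre.S.functor.obj c)).1
  have := (hfinite d (serre.S.functor.obj c)).2
  obtain ⟨m, p, q, -, -, hpq⟩ :=
    Module.Finite.exists_comp_eq_id_of_projective k (d ⟶ serre.S.functor.obj c)
  let left (j : Fin m) : c ⟶ d := (serre.σ c d).symm (LinearMap.proj j ∘ₗ q)
  let right (j : Fin m) : d ⟶ serre.S.functor.obj c := p (Pi.single j 1)
  have hl (j : Fin m) (g : d ⟶ serre.S.functor.obj c) :
      serre.σ c c (𝟙 c) (left j ≫ g) = q g j := by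
    rw [← hσ, LinearEquiv.apply_symm_apply]
    rfl
  have hr (g : d ⟶ serre.S.functor.obj c) :
      ∑ j, serre.σ c c (𝟙 c) (left j ≫ g) • right j = g := by
    simp only [hl, right, ← map_smul, ← map_sum]
    have : ∑ j, q g j • (Pi.single j 1 : Fin m → k) = q g := by
      ext i
      simp [Pi.single_apply]
    rw [this]
    exact LinearMap.congr_fun hpq g
  refine ⟨⟨m, left, right, fun h => (serre.σ c d).injective (LinearMap.ext fun g => ?_), hr⟩⟩
  conv_rhs => rw [hσ, ← hr g]
  simp [map_sum, hσ, Preadditive.comp_sum, mul_comm]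

/-- Every object `c` is the target of a trace with dual bases: its source is the preimage of `c`
under the Serre functor. -/
lemma SerreFunctor.exists_dualBases (hfinite : IsHomFinite k C) (serre : SerreFunctor k C)
    (c : C) : ∃ (a : C) (τ : (a ⟶ c) →ₗ[k] k), ∀ d, Nonempty (DualBases τ d) := by
  let a := serre.S.inverse.obj c
  let e : serre.S.functor.obj a ≅ c := serre.S.counitIso.app c
  refine ⟨a, serre.σ a a (𝟙 a) ∘ₗ Linear.rightComp k a e.inv, fun d => ?_⟩
  obtain ⟨B⟩ := serre.nonempty_dualBases hfinite a d
  refine ⟨⟨B.m, B.left, fun j => B.right j ≫ e.hom, fun h => ?_, fun g => ?_⟩⟩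
  · simpa using B.sum_left h
  · have := congrArg (· ≫ e.hom) (B.sum_right (g ≫ e.inv))
    simpa [Preadditive.sum_comp] using this

/-- Only finitely many `Hom(a i, d)` are nonzero. -/
def IsLocallyFiniteFamily {I : Type u} (a : I → C) : Prop :=
  ∀ d, {i | ∃ h : a i ⟶ d, h ≠ 0}.Finite

lemma isLocallyFiniteFamily_of_dualBases (hbounded : IsLocallyBounded C) {a : C → C}
    {τ : ∀ c, (a c ⟶ c) →ₗ[k] k} (hτ : ∀ c d, Nonempty (DualBases (τ c) d)) :
    IsLocallyFiniteFamily a := by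
  refine fun d => (hbounded d).2.subset ?_
  rintro c ⟨h, hh⟩
  obtain ⟨B⟩ := hτ c d
  by_contra hc
  have hc' (g : d ⟶ c) : g = 0 := by_contra fun hg => hc ⟨g, hg⟩
  exact hh (by rw [← B.sum_left h]; simp [hc'])

end DualBases

namespace RightMod

open ScalarExt Opposite

variable {k R C : Type u} [CommRing k] [Ring R] [Algebra k R]
  [Category.{u} C] [Preadditive C] [Linear k C]

attribute [local instance] restrictModule

variable {I : Type u} {a b : I → C} {X Y : I → ModuleCat.{u} Rᵐᵒᵖ}
  {M N : RightMod k (ScalarExt k R C)}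

section Lift

/-! ### Coinduction as a right adjoint -/

lemma algebraMap_smul_map {V : ModuleCat.{u} Rᵐᵒᵖ} {c : C} (φ : (value c).obj M ⟶ V) (r : k)
    (m : (value c).obj M) : φ.hom (algebraMap k Rᵐᵒᵖ r • m) = r • φ.hom m :=
  map_smul φ.hom _ m

/-- The morphism to a coinduced module given by a family of homomorphisms `M (a i) ⟶ X i`. -/
noncomputable def coindLift (φ : ∀ i, (value (a i)).obj M ⟶ X i) : M ⟶ coind a X :=
  homMk (fun c => (coindEquiv a X c).symm.toLinearMap ∘ₗ
      { toFun m i :=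
          { toFun h := (φ i).hom (M.restr h m)
            map_add' h h' := by rw [restr_add, map_add]
            map_smul' r h := by
              rw [restr_smul, algebraMap_smul_map]
              rfl }
        map_add' m m' := by
          ext i h
          simp
        map_smul' s m := by
          ext i h
          simp })
    fun c d f m => coind_ext fun i h => by
      rw [coindEquiv_restr]
      simp [restr_comp]

lemma coindEquiv_coindLift (φ : ∀ i, (value (a i)).obj M ⟶ X i) {c : C} (m : (value c).obj M)
    (i : I) (h : a i ⟶ c) :
    coindEquiv a X c (((value c).map (coindLift φ)).hom m) i h = (φ i).hom (M.restr h m) := by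
  simp [coindLift]

variable (a X) in
/-- Evaluation of a coinduced module at the identity of `a i`. -/
noncomputable def coindEval (i : I) : (value (a i)).obj (coind (k := k) a X) ⟶ X i :=
  ModuleCat.homEquiv.symm
    { toFun u := coindEquiv a X (a i) u i (𝟙 (a i))
      map_add' u v := by simp
      map_smul' s u := by simp }

lemma coindEval_apply (i : I) (u : (value (a i)).obj (coind (k := k) a X)) :
    (coindEval a X i).hom u = coindEquiv a X (a i) u i (𝟙 (a i)) := rfl

lemma coindEquiv_eq_coindEval {c : C} (u : (value c).obj (coind (k := k) a X)) (i : I)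
    (h : a i ⟶ c) :
    coindEquiv a X c u i h = (coindEval a X i).hom ((coind a X).restr h u) := by
  rw [coindEval_apply, coindEquiv_restr, Category.id_comp]

instance value_map_mono (f : M ⟶ N) [Mono f] (c : C) : Mono ((value c).map f) :=
  (ModuleCat.mono_iff_injective _).2 (injective_of_mono f ⟨c⟩)

instance value_map_epi (f : M ⟶ N) [Epi f] (c : C) : Epi ((value c).map f) :=
  (ModuleCat.epi_iff_surjective _).2 (surjective_of_epi f ⟨c⟩)

instance injective_coind [∀ i, Injective (X i)] : Injective (coind (k := k) a X) where
  factors {M N} g f _ := by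
    refine ⟨coindLift fun i =>
      Injective.factorThru ((value (a i)).map g ≫ coindEval a X i) ((value (a i)).map f), ?_⟩
    apply hom_ext
    intro c m
    refine coind_ext fun i h => ?_
    rw [Functor.map_comp, ModuleCat.hom_comp, LinearMap.comp_apply, coindEquiv_coindLift,
      ← map_restr, ← LinearMap.comp_apply, ← ModuleCat.hom_comp, Injective.comp_factorThru,
      coindEquiv_eq_coindEval, ModuleCat.hom_comp, LinearMap.comp_apply, map_restr]

end Lift

section Desc

/-! ### Coinduction as a left adjoint -/

variable {τ : ∀ i, (a i ⟶ b i) →ₗ[k] k}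

/-- Under duality, coinduction at `a i` is induction from `b i`, with this unit. -/
noncomputable def coindUnit [DecidableEq I] (τ : ∀ i, (a i ⟶ b i) →ₗ[k] k)
    (X : I → ModuleCat.{u} Rᵐᵒᵖ) (i : I) : X i ⟶ (value (b i)).obj (coind (k := k) a X) :=
  ModuleCat.homEquiv.symm <| (coindEquiv a X (b i)).symm.toLinearMap ∘ₗ
    LinearMap.single Rᵐᵒᵖ (fun i' => (a i' ⟶ b i) →ₗ[k] X i') i ∘ₗ
      { toFun x := (τ i).smulRight x
        map_add' x y := by
          ext h
          simp
        map_smul' s x := by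
          ext h
          exact smul_comm (τ i h) s x }

lemma coindEquiv_coindUnit [DecidableEq I] (i : I) (x : X i) :
    coindEquiv a X (b i) ((coindUnit τ X i).hom x) i = (τ i).smulRight x := by
  simp [coindUnit, ModuleCat.homEquiv]

lemma coindEquiv_coindUnit_of_ne [DecidableEq I] {i i' : I} (hi : i' ≠ i) (x : X i) :
    coindEquiv a X (b i) ((coindUnit τ X i).hom x) i' = 0 := by
  simp [coindUnit, ModuleCat.homEquiv, hi]

/-- The component at `i` of `coindDesc`. -/
noncomputable def coindDescComponent (B : ∀ i d, DualBases (τ i) d)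
    (ψ : ∀ i, X i ⟶ (value (b i)).obj M) (i : I) (d : C) :
    (value d).obj (coind (k := k) a X) →ₗ[Rᵐᵒᵖ] (value d).obj M where
  toFun u := ∑ j, M.restr ((B i d).right j) ((ψ i).hom (coindEquiv a X d u i ((B i d).left j)))
  map_add' u v := by simp [Finset.sum_add_distrib]
  map_smul' s u := by simp [Finset.smul_sum]

lemma map_restrictModule_smul {V : ModuleCat.{u} Rᵐᵒᵖ} {c : C} (ψ : V ⟶ (value c).obj M) (r : k)
    (v : V) : ψ.hom (r • v) = algebraMap k Rᵐᵒᵖ r • ψ.hom v :=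
  map_smul ψ.hom (algebraMap k Rᵐᵒᵖ r) v

lemma coindDescComponent_restr (B : ∀ i d, DualBases (τ i) d)
    (ψ : ∀ i, X i ⟶ (value (b i)).obj M) (i : I) {c d : C} (f : c ⟶ d)
    (u : (value d).obj (coind (k := k) a X)) :
    coindDescComponent B ψ i c ((coind a X).restr f u) =
      M.restr f (coindDescComponent B ψ i d u) := by
  -- Both sides are the sum over `j, l` of `τ (left l ≫ f ≫ right j)` times a term in `j, l`.
  simp only [coindDescComponent, LinearMap.coe_mk, AddHom.coe_mk, coindEquiv_restr]
  have hl (l : Fin (B i c).m) : coindEquiv a X d u i ((B i c).left l ≫ f) =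
      ∑ j, τ i (((B i c).left l ≫ f) ≫ (B i d).right j) •
        coindEquiv a X d u i ((B i d).left j) := by
    conv_lhs => rw [← (B i d).sum_left ((B i c).left l ≫ f)]
    rw [map_sum]
    simp only [map_smul]
  have hr (j : Fin (B i d).m) : f ≫ (B i d).right j =
      ∑ l, τ i ((B i c).left l ≫ f ≫ (B i d).right j) • (B i c).right l :=
    ((B i c).sum_right _).symm
  simp only [hl, map_sum, map_restrictModule_smul]
  rw [Finset.sum_comm]
  refine Finset.sum_congr rfl fun j _ => ?_
  rw [← restr_comp, hr, restr_sum]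
  refine Finset.sum_congr rfl fun l _ => ?_
  rw [restr_smul, map_smul, Category.assoc]

lemma coindDescComponent_eq_zero (B : ∀ i d, DualBases (τ i) d)
    (ψ : ∀ i, X i ⟶ (value (b i)).obj M) (i : I) (d : C)
    (u : (value d).obj (coind (k := k) a X)) (h : coindEquiv a X d u i = 0) :
    coindDescComponent B ψ i d u = 0 := by
  simp [coindDescComponent, h]

lemma coindEquiv_eq_zero (ha : IsLocallyFiniteFamily a) {i : I} {d : C} (hi : i ∉ (ha d).toFinset)
    (u : (value d).obj (coind (k := k) a X)) : coindEquiv a X d u i = 0 := by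
  ext h
  have : h = 0 := by_contra fun hh => hi ((ha d).mem_toFinset.2 ⟨h, hh⟩)
  simp [this]

/-- The morphism from a coinduced module given by a family of homomorphisms `X i ⟶ M (b i)`. -/
noncomputable def coindDesc (ha : IsLocallyFiniteFamily a) (B : ∀ i d, DualBases (τ i) d)
    (ψ : ∀ i, X i ⟶ (value (b i)).obj M) : coind (k := k) a X ⟶ M :=
  homMk (fun d => ∑ i ∈ (ha d).toFinset, coindDescComponent B ψ i d)
    fun c d f u => by
      classical
      simp only [LinearMap.sum_apply, map_sum, ← coindDescComponent_restr]
      trans ∑ i ∈ (ha c).toFinset ∪ (ha d).toFinset,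
        coindDescComponent B ψ i c ((coind a X).restr f u)
      · exact Finset.sum_subset Finset.subset_union_left fun i _ hi =>
          coindDescComponent_eq_zero _ _ _ _ _ (coindEquiv_eq_zero ha hi _)
      · refine (Finset.sum_subset Finset.subset_union_right fun i _ hi =>
          coindDescComponent_eq_zero _ _ _ _ _ ?_).symm
        ext h
        rw [coindEquiv_restr, coindEquiv_eq_zero ha hi]
        rfl

lemma value_map_coindDesc (ha : IsLocallyFiniteFamily a) (B : ∀ i d, DualBases (τ i) d)
    (ψ : ∀ i, X i ⟶ (value (b i)).obj M) {d : C} (u : (value d).obj (coind (k := k) a X)) :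
    ((value d).map (coindDesc ha B ψ)).hom u =
      ∑ i ∈ (ha d).toFinset, coindDescComponent B ψ i d u := by
  simp [coindDesc]

lemma coindUnit_coindDesc [DecidableEq I] (ha : IsLocallyFiniteFamily a)
    (B : ∀ i d, DualBases (τ i) d) (ψ : ∀ i, X i ⟶ (value (b i)).obj M) (i : I) (x : X i) :
    ((value (b i)).map (coindDesc ha B ψ)).hom ((coindUnit τ X i).hom x) = (ψ i).hom x := by
  rw [value_map_coindDesc, Finset.sum_eq_single i]
  · simp only [coindDescComponent, LinearMap.coe_mk, AddHom.coe_mk, coindEquiv_coindUnit,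
      LinearMap.smulRight_apply, map_restrictModule_smul, map_smul, ← restr_smul, ← restr_sum]
    conv_rhs => rw [← M.restr_id (b i) ((ψ i).hom x), ← (B i (b i)).sum_right (𝟙 (b i))]
    simp only [Category.comp_id]
  · intro i' _ hi
    exact coindDescComponent_eq_zero _ _ _ _ _ (coindEquiv_coindUnit_of_ne hi x)
  · intro hi
    exact coindDescComponent_eq_zero _ _ _ _ _ (coindEquiv_eq_zero ha hi _)

/-- The images of the units generate a coinduced module. -/
lemma eq_sum_restr_coindUnit [DecidableEq I] (ha : IsLocallyFiniteFamily a)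
    (B : ∀ i d, DualBases (τ i) d) {d : C} (u : (value d).obj (coind (k := k) a X)) :
    u = ∑ i ∈ (ha d).toFinset, ∑ j, (coind a X).restr ((B i d).right j)
      ((coindUnit τ X i).hom (coindEquiv a X d u i ((B i d).left j))) := by
  refine coind_ext fun i h => ?_
  simp only [map_sum, Finset.sum_apply, LinearMap.sum_apply, coindEquiv_restr]
  rw [Finset.sum_eq_single i]
  · simp only [coindEquiv_coindUnit, LinearMap.smulRight_apply, ← map_smul, ← map_sum]
    rw [(B i d).sum_left]
  · intro i' _ hi
    simp [coindEquiv_coindUnit_of_ne hi.symm]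
  · intro hi
    simp [coindEquiv_eq_zero ha hi]

lemma coind_hom_ext [DecidableEq I] (ha : IsLocallyFiniteFamily a) (B : ∀ i d, DualBases (τ i) d)
    {f g : coind (k := k) a X ⟶ M}
    (h : ∀ i x, ((value (b i)).map f).hom ((coindUnit τ X i).hom x) =
      ((value (b i)).map g).hom ((coindUnit τ X i).hom x)) : f = g := by
  apply hom_ext
  intro d u
  rw [eq_sum_restr_coindUnit ha B u]
  simp only [map_sum, map_restr, h]

lemma projective_coind (ha : IsLocallyFiniteFamily a) (B : ∀ i d, DualBases (τ i) d)
    [∀ i, Projective (X i)] : Projective (coind (k := k) a X) where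
  factors {M N} f e _ := by
    classical
    refine ⟨coindDesc ha B fun i =>
      Projective.factorThru (coindUnit τ X i ≫ (value (b i)).map f) ((value (b i)).map e), ?_⟩
    apply coind_hom_ext ha B
    intro i x
    rw [Functor.map_comp, ModuleCat.hom_comp, LinearMap.comp_apply, coindUnit_coindDesc,
      ← LinearMap.comp_apply, ← ModuleCat.hom_comp, Projective.factorThru_comp, ModuleCat.hom_comp,
      LinearMap.comp_apply]

end Desc

end RightMod

namespace RightMod

open ScalarExt Opposite

variable {k R C : Type u} [CommRing k] [Ring R] [Algebra k R]
  [Category.{u} C] [Preadditive C] [Linear k C]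

attribute [local instance] restrictModule

section Dimensions

/-! ### Homological dimensions of coinduced modules -/

variable {I : Type u} {a b : I → C} {X : I → ModuleCat.{u} Rᵐᵒᵖ}

lemma hasInjectiveDimensionLE_coind (hfinite : IsHomFinite k C) {n : ℕ}
    (hX : ∀ i, HasInjectiveDimensionLE (X i) n) :
    HasInjectiveDimensionLE (coind (k := k) a X) n := by
  induction n generalizing X with
  | zero =>
    have (i : I) : Injective (X i) := injective_iff_hasInjectiveDimensionLT_one.2 (hX i)
    exact injective_iff_hasInjectiveDimensionLT_one.1 inferInstance
  | succ n ih =>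
    let S (i : I) : ShortComplex (ModuleCat.{u} Rᵐᵒᵖ) :=
      ShortComplex.mk _ _ (cokernel.condition (Injective.ι (X i)))
    have hS (i : I) : (S i).ShortExact := { exact := ShortComplex.exact_cokernel _ }
    have hinj (i : I) : Injective (S i).X₂ := inferInstanceAs (Injective (Injective.under (X i)))
    refine ((shortExact_coindMap hfinite S hS).hasInjectiveDimensionLT_X₃_iff n
      (inferInstanceAs (Injective (coind a fun i => (S i).X₂)))).1 (ih fun i => ?_)
    exact ((hS i).hasInjectiveDimensionLT_X₃_iff n (hinj i)).2 (hX i)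

lemma hasProjectiveDimensionLE_coind (hfinite : IsHomFinite k C)
    (ha : IsLocallyFiniteFamily a) {τ : ∀ i, (a i ⟶ b i) →ₗ[k] k} (B : ∀ i d, DualBases (τ i) d)
    {n : ℕ} (hX : ∀ i, HasProjectiveDimensionLE (X i) n) :
    HasProjectiveDimensionLE (coind (k := k) a X) n := by
  induction n generalizing X with
  | zero =>
    have (i : I) : Projective (X i) := projective_iff_hasProjectiveDimensionLT_one.2 (hX i)
    exact projective_iff_hasProjectiveDimensionLT_one.1 (projective_coind ha B)
  | succ n ih =>
    let S (i : I) : ShortComplex (ModuleCat.{u} Rᵐᵒᵖ) :=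
      ShortComplex.mk _ _ (kernel.condition (Projective.π (X i)))
    have hS (i : I) : (S i).ShortExact := { exact := ShortComplex.exact_kernel _ }
    have hproj (i : I) : Projective (S i).X₂ :=
      inferInstanceAs (Projective (Projective.over (X i)))
    refine ((shortExact_coindMap hfinite S hS).hasProjectiveDimensionLT_X₃_iff n
      (projective_coind (X := fun i => (S i).X₂) ha B)).2 (ih fun i => ?_)
    exact ((hS i).hasProjectiveDimensionLT_X₃_iff n (hproj i)).1 (hX i)

end Dimensions

section Generators

/-! ### Enough projectives and injectives -/

/-- Every right module is a quotient of a module coinduced from projectives. -/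
lemma exists_epi_coind {a : C → C} {τ : ∀ c, (a c ⟶ c) →ₗ[k] k} (ha : IsLocallyFiniteFamily a)
    (B : ∀ c d, DualBases (τ c) d) (M : RightMod k (ScalarExt k R C)) :
    ∃ (F : C → ModuleCat.{u} Rᵐᵒᵖ) (p : coind (k := k) a F ⟶ M),
      (∀ c, Projective (F c)) ∧ Epi p := by
  classical
  let ψ (c : C) := Projective.π ((value c).obj M)
  refine ⟨fun c => Projective.over ((value c).obj M), coindDesc ha B ψ, fun c => inferInstance,
    epi_of_surjective _ ?_⟩
  rintro ⟨c⟩ m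
  obtain ⟨x, hx⟩ := (ModuleCat.epi_iff_surjective (ψ c)).1 inferInstance m
  exact ⟨_, (coindUnit_coindDesc ha B ψ c x).trans hx⟩

/-- Every right module embeds in a module coinduced from injectives. -/
lemma exists_mono_coind (M : RightMod k (ScalarExt k R C)) :
    ∃ (E : C → ModuleCat.{u} Rᵐᵒᵖ) (j : M ⟶ coind (k := k) (fun c => c) E),
      (∀ c, Injective (E c)) ∧ Mono j := by
  let φ (c : C) := Injective.ι ((value c).obj M)
  refine ⟨fun c => Injective.under ((value c).obj M), coindLift φ, fun c => inferInstance,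
    mono_of_injective _ ?_⟩
  rintro ⟨c⟩ m m' h
  refine (ModuleCat.mono_iff_injective (φ c)).1 inferInstance ?_
  have := congrArg (fun u => coindEquiv (fun c => c) _ c u c (𝟙 c)) h
  have hm (m : (value c).obj M) := (coindEquiv_coindLift (a := fun c : C => c) φ m c (𝟙 c)).trans
    (congrArg (φ c).hom (M.restr_id c m))
  exact (hm m).symm.trans (this.trans (hm m'))

/-- The module coinduced from copies of `R` is a projective separator. -/
lemma exists_projective_separator {a : C → C} {τ : ∀ c, (a c ⟶ c) →ₗ[k] k}
    (ha : IsLocallyFiniteFamily a) (B : ∀ c d, DualBases (τ c) d) :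
    ∃ G : RightMod k (ScalarExt k R C), IsSeparator G ∧ Projective G := by
  classical
  refine ⟨coind a fun _ => ModuleCat.of Rᵐᵒᵖ Rᵐᵒᵖ, ?_, ?_⟩
  · rw [isSeparator_def]
    intro M N f g hfg
    apply hom_ext
    intro c m
    let φ : ModuleCat.of Rᵐᵒᵖ Rᵐᵒᵖ ⟶ (value c).obj M :=
      ModuleCat.homEquiv.symm (LinearMap.toSpanSingleton Rᵐᵒᵖ _ m)
    let ψ (d : C) : ModuleCat.of Rᵐᵒᵖ Rᵐᵒᵖ ⟶ (value d).obj M :=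
      Function.update (β := fun d => ModuleCat.of Rᵐᵒᵖ Rᵐᵒᵖ ⟶ (value d).obj M) (fun _ => 0) c φ d
    have hψ : ψ c = φ := Function.update_self ..
    have h := coindUnit_coindDesc ha B ψ c 1
    have hφ : φ.hom 1 = m := one_smul _ m
    rw [hψ, hφ] at h
    have hcomp (q : M ⟶ N) (x : (value c).obj (coind (k := k) a fun _ => ModuleCat.of Rᵐᵒᵖ Rᵐᵒᵖ)) :
        ((value c).map q).hom (((value c).map (coindDesc ha B ψ)).hom x) =
          ((value c).map (coindDesc ha B ψ ≫ q)).hom x := by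
      rw [Functor.map_comp]
      rfl
    rw [← h, hcomp f, hcomp g, hfg]
  · have : Projective (ModuleCat.of Rᵐᵒᵖ Rᵐᵒᵖ) :=
      (IsProjective.iff_projective _).1 inferInstance
    exact projective_coind ha B

end Generators

section Value

/-! ### Injective dimension of values -/

instance (c : C) : (value (k := k) (R := R) c).Additive where

lemma shortExact_map_value {S : ShortComplex (RightMod k (ScalarExt k R C))} (hS : S.ShortExact)
    (c : C) : (S.map (value c)).ShortExact := by
  have h := hS.map_of_exact (eval ⟨c⟩)
  exact
    { exact := (ShortComplex.ShortExact.moduleCat_exact_iff_function_exact _).2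
        ((ShortComplex.ShortExact.moduleCat_exact_iff_function_exact _).1 h.exact :)
      mono_f := (ModuleCat.mono_iff_injective _).2 ((ModuleCat.mono_iff_injective _).1 h.mono_f :)
      epi_g := (ModuleCat.epi_iff_surjective _).2 ((ModuleCat.epi_iff_surjective _).1 h.epi_g :) }

variable {I : Type u} {a b : I → C} {X Y : I → ModuleCat.{u} Rᵐᵒᵖ} {τ : ∀ i, (a i ⟶ b i) →ₗ[k] k}

instance mono_coindMap (φ : ∀ i, X i ⟶ Y i) [∀ i, Mono (φ i)] :
    Mono (coindMap (k := k) (a := a) φ) := by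
  refine mono_of_injective _ ?_
  rintro ⟨c⟩ u v h
  refine coind_ext fun i f => (ModuleCat.mono_iff_injective (φ i)).1 inferInstance ?_
  have := congrArg (fun w => coindEquiv a _ c w i f) h
  exact (coindEquiv_coindMap φ u i f).symm.trans (this.trans (coindEquiv_coindMap φ v i f))

lemma coindMap_coindUnit [DecidableEq I] (φ : ∀ i, X i ⟶ Y i) (i : I) (x : X i) :
    ((value (b i)).map (coindMap φ)).hom ((coindUnit τ X i).hom x) =
      (coindUnit τ Y i).hom ((φ i).hom x) := by
  refine coind_ext fun i' h => ?_
  rw [coindEquiv_coindMap]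
  obtain rfl | hi := eq_or_ne i' i
  · rw [coindEquiv_coindUnit, coindEquiv_coindUnit]
    exact map_smul (homK (k := k) (φ i')) _ _
  · simp [coindEquiv_coindUnit_of_ne hi]

variable {a c : C} {τ : (a ⟶ c) →ₗ[k] k}

lemma isLocallyFiniteFamily_of_finite {J : Type u} [Finite J] (a : J → C) :
    IsLocallyFiniteFamily a :=
  fun _ => Set.toFinite _

/-- The value at `c` preserves injectives, as its left adjoint, coinduction from `a`, preserves
monomorphisms. -/
lemma injective_value (B : ∀ d, DualBases τ d) (M : RightMod k (ScalarExt k R C)) [Injective M] :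
    Injective ((value c).obj M) where
  factors {V W} g f _ := by
    let a' : PUnit.{u + 1} → C := fun _ => a
    let b' : PUnit.{u + 1} → C := fun _ => c
    let τ' (i : PUnit.{u + 1}) : (a' i ⟶ b' i) →ₗ[k] k := τ
    let B' (i : PUnit.{u + 1}) (d : C) : DualBases (τ' i) d := B d
    let f' : coind (k := k) a' (fun _ => V) ⟶ coind a' (fun _ => W) := coindMap fun _ => f
    let g' : coind (k := k) a' (fun _ => V) ⟶ M :=
      coindDesc (isLocallyFiniteFamily_of_finite a') B' fun _ => g
    have : Mono f' := mono_coindMap _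
    let e := Injective.factorThru g' f'
    refine ⟨coindUnit τ' (fun _ => W) PUnit.unit ≫ (value c).map e, ?_⟩
    ext x
    have h1 := coindMap_coindUnit (τ := τ') (fun _ => f) PUnit.unit x
    have h2 := coindUnit_coindDesc (isLocallyFiniteFamily_of_finite a') B' (fun _ => g)
      PUnit.unit x
    have h3 : f' ≫ e = g' := Injective.comp_factorThru g' f'
    change ((value c).map e).hom ((coindUnit τ' (fun _ => W) PUnit.unit).hom (f.hom x)) = _
    refine (congrArg ((value c).map e).hom h1.symm).trans ?_
    refine Eq.trans ?_ h2
    change _ = ((value c).map g').hom _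
    rw [← h3, Functor.map_comp]
    rfl

lemma hasInjectiveDimensionLE_value [IsGrothendieckAbelian.{u} (RightMod k (ScalarExt k R C))]
    (B : ∀ d, DualBases τ d) {M : RightMod k (ScalarExt k R C)} {n : ℕ}
    (hM : HasInjectiveDimensionLE M n) : HasInjectiveDimensionLE ((value c).obj M) n := by
  induction n generalizing M with
  | zero =>
    have : Injective M := injective_iff_hasInjectiveDimensionLT_one.2 hM
    exact injective_iff_hasInjectiveDimensionLT_one.1 (injective_value B M)
  | succ n ih =>
    have hS : (ShortComplex.mk _ _ (cokernel.condition (Injective.ι M))).ShortExact :=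
      { exact := ShortComplex.exact_cokernel _ }
    exact ((shortExact_map_value hS c).hasInjectiveDimensionLT_X₃_iff n
      (injective_value B (Injective.under M))).1
      (ih ((hS.hasInjectiveDimensionLT_X₃_iff n
        (inferInstanceAs (Injective (Injective.under M)))).2 hM))

/-- If the structure map `k → End_R(V)` extends along `k → End c` to a `k`-linear map `T`, then `V`
is a direct summand of the value at `c` of the module coinduced from `V`: this value is `V ⊗ End c` by
duality, and `v ⊗ f ↦ T f v` is a retraction. -/
lemma exists_retract_value_coind (B : ∀ d, DualBases τ d) (V : ModuleCat.{u} Rᵐᵒᵖ)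
    (T : (c ⟶ c) → V →ₗ[Rᵐᵒᵖ] V) (hadd : ∀ f g, T (f + g) = T f + T g)
    (hsmul : ∀ (r : k) f v, T (r • f) v = algebraMap k Rᵐᵒᵖ r • T f v)
    (hone : T (𝟙 c) = LinearMap.id) :
    Nonempty (Retract V
      ((value c).obj (coind (k := k) (fun _ : PUnit.{u + 1} => a) fun _ => V))) := by
  classical
  let a' : PUnit.{u + 1} → C := fun _ => a
  let b' : PUnit.{u + 1} → C := fun _ => c
  let τ' (i : PUnit.{u + 1}) : (a' i ⟶ b' i) →ₗ[k] k := τ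
  let X (_ : PUnit.{u + 1}) : ModuleCat.{u} Rᵐᵒᵖ := V
  let T' : (c ⟶ c) →+ (V →ₗ[Rᵐᵒᵖ] V) := AddMonoidHom.mk' T hadd
  let ρ : (value c).obj (coind (k := k) a' X) ⟶ V := ModuleCat.homEquiv.symm
    { toFun u := ∑ j, T ((B c).right j) (coindEquiv a' X c u PUnit.unit ((B c).left j))
      map_add' u v := by simp [Finset.sum_add_distrib]
      map_smul' s u := by simp [Finset.smul_sum] }
  refine ⟨⟨coindUnit τ' X PUnit.unit, ρ, ?_⟩⟩
  ext v
  change ∑ j, T ((B c).right j) (coindEquiv a' X c ((coindUnit τ' X PUnit.unit).hom v) PUnit.unit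
    ((B c).left j)) = v
  have h : coindEquiv a' X c ((coindUnit τ' X PUnit.unit).hom v) PUnit.unit = τ.smulRight v :=
    coindEquiv_coindUnit (X := X) (τ := τ') PUnit.unit v
  have hT (j : Fin (B c).m) : T ((B c).right j) (τ ((B c).left j) • v) =
      T (τ ((B c).left j) • (B c).right j) v :=
    (map_smul (T ((B c).right j)) (algebraMap k Rᵐᵒᵖ _) v).trans (hsmul _ _ _).symm
  have hsum : ∑ j, τ ((B c).left j) • (B c).right j = 𝟙 c := by
    simpa using (B c).sum_right (𝟙 c)
  simp only [h, LinearMap.smulRight_apply, hT]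
  rw [← LinearMap.sum_apply]
  change (∑ j, T' _) v = v
  rw [← map_sum, hsum]
  exact LinearMap.congr_fun hone v

/-- A right `R`-linear retraction `ρ` of `R → R ⊗ End c` makes every free right `R`-module a direct
summand of the value at `c` of its coinduced module: `f : c ⟶ c` acts on the coordinates by left
multiplication by `ρ (1 ⊗ f)`. -/
lemma exists_retract_value_coind_of_retraction (B : ∀ d, DualBases τ d)
    (ρ : (R ⊗[k] (c ⟶ c)) →ₗ[Rᵐᵒᵖ] R) (hρ : ∀ r : R, ρ (r ⊗ₜ[k] 𝟙 c) = r) (J : Type u) :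
    Nonempty (Retract (ModuleCat.of Rᵐᵒᵖ (J →₀ Rᵐᵒᵖ))
      ((value c).obj (coind (k := k) (fun _ : PUnit.{u + 1} => a)
        fun _ => ModuleCat.of Rᵐᵒᵖ (J →₀ Rᵐᵒᵖ)))) := by
  have hmul (r : k) (f : c ⟶ c) : ρ (1 ⊗ₜ (r • f)) = algebraMap k R r * ρ (1 ⊗ₜ f) := by
    have h : (1 : R) ⊗ₜ[k] (r • f) =
        MulOpposite.op (algebraMap k R r) • ((1 : R) ⊗ₜ[k] f) := by
      rw [TensorProduct.smul_tmul', ← TensorProduct.smul_tmul, op_smul_eq_mul,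
        one_mul, Algebra.algebraMap_eq_smul_one]
    rw [h, map_smul, op_smul_eq_mul, Algebra.commutes]
  let T (f : c ⟶ c) : (J →₀ Rᵐᵒᵖ) →ₗ[Rᵐᵒᵖ] (J →₀ Rᵐᵒᵖ) :=
    Finsupp.mapRange.linearMap
      (LinearMap.toSpanSingleton Rᵐᵒᵖ Rᵐᵒᵖ (MulOpposite.op (ρ (1 ⊗ₜ f))))
  have hT (f : c ⟶ c) (v : J →₀ Rᵐᵒᵖ) (j : J) :
      T f v j = v j * MulOpposite.op (ρ (1 ⊗ₜ f)) := rfl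
  refine exists_retract_value_coind B _ T (fun f g => ?_) (fun r f v => ?_) ?_
  · refine LinearMap.ext fun v => Finsupp.ext fun j => ?_
    rw [LinearMap.add_apply, Finsupp.add_apply, hT, hT, hT, TensorProduct.tmul_add, map_add,
      MulOpposite.op_add, mul_add]
  · refine Finsupp.ext fun j => ?_
    change T (r • f) v j = algebraMap k Rᵐᵒᵖ r * T f v j
    rw [hT, hT, hmul, MulOpposite.op_mul, ← mul_assoc, ← mul_assoc,
      Algebra.commutes r (v j), mul_assoc, mul_assoc]
    congr 1
    exact (Algebra.commutes r (MulOpposite.op (ρ (1 ⊗ₜ f)))).symm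
  · refine LinearMap.ext fun v => Finsupp.ext fun j => ?_
    rw [hT, hρ, MulOpposite.op_one, mul_one]
    rfl

end Value

end RightMod

section Retracts

variable {A : Type w} [Category.{v} A]

/-- A projective quotient is a direct summand. -/
lemma nonempty_retract_of_epi {P X : A} [Projective P] (p : X ⟶ P) [Epi p] :
    Nonempty (Retract P X) :=
  ⟨⟨Projective.factorThru (𝟙 P) p, p, Projective.factorThru_comp _ _⟩⟩

/-- An injective subobject is a direct summand. -/
lemma nonempty_retract_of_mono {I X : A} [Injective I] (j : I ⟶ X) [Mono j] :
    Nonempty (Retract I X) :=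
  ⟨⟨j, Injective.factorThru (𝟙 I) j, Injective.comp_factorThru _ _⟩⟩

end Retracts

theorem theorem4p6 (k : Type u) [CommRing k]
    (C : Type u) [Category.{u} C] [Preadditive C] [Linear k C]
    (hbounded : IsLocallyBounded C) (hfinite : IsHomFinite k C) (serre : SerreFunctor k C)
    (R : Type u) [Ring R] [Algebra k R] (n : ℕ) (hR : IsNGorensteinRing R n) :
    ∃ n' : ℕ, n' ≤ n ∧ IsNGorensteinSmallCategory k (ScalarExt k R C) n' ∧
      (Nonempty C →
        (∀ c : C, ∃ ρ : (R ⊗[k] (c ⟶ c)) →ₗ[Rᵐᵒᵖ] R, ∀ r : R, ρ (r ⊗ₜ[k] 𝟙 c) = r) →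
        n' = n) := by
  choose a τ hB using serre.exists_dualBases hfinite
  have B (c d : C) : DualBases (τ c) d := (hB c d).some
  have ha : IsLocallyFiniteFamily a := isLocallyFiniteFamily_of_dualBases hbounded hB
  have BS (c d : C) : DualBases (serre.σ c c (𝟙 c)) d :=
    (serre.nonempty_dualBases hfinite c d).some
  have hid : IsLocallyFiniteFamily fun c : C => c := fun d => (hbounded d).1
  obtain ⟨G, hG, hG'⟩ := RightMod.exists_projective_separator (R := R) ha B
  have : HasSeparator (RightMod k (ScalarExt k R C)) := ⟨⟨G, hG⟩⟩
  have hGro : IsGrothendieckAbelian.{u} (RightMod k (ScalarExt k R C)) :=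
    RightMod.isGrothendieckAbelian_of_hasSeparator k (ScalarExt k R C)
  have : EnoughProjectives (RightMod k (ScalarExt k R C)) := ⟨fun M => by
    obtain ⟨F, p, hF, hp⟩ := RightMod.exists_epi_coind ha B M
    exact ⟨{ p := _, projective := RightMod.projective_coind ha B, f := p, epi := hp }⟩⟩
  have hR' : IsNGorensteinCategory (ModuleCat.{u} Rᵐᵒᵖ) n := hR
  obtain ⟨n', hn', h⟩ := exists_isNGorensteinCategory (n := n) ⟨G, hG, hG'⟩
    (fun P _ => by
      obtain ⟨F, p, hF, hp⟩ := RightMod.exists_epi_coind ha B P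
      obtain ⟨r⟩ := nonempty_retract_of_epi p
      have := RightMod.hasInjectiveDimensionLE_coind (a := a) hfinite
        fun c => hR'.injectiveDimension_le (F c)
      exact r.hasInjectiveDimensionLT _)
    (fun E _ => by
      obtain ⟨X, j, hX, hj⟩ := RightMod.exists_mono_coind E
      obtain ⟨r⟩ := nonempty_retract_of_mono j
      have := RightMod.hasProjectiveDimensionLE_coind hfinite hid BS
        fun c => hR'.projectiveDimension_le (X c)
      exact r.hasProjectiveDimensionLT _)
  refine ⟨n', hn', h, fun ⟨c⟩ hρ => le_antisymm hn' (hR'.le_of_projective_le fun P _ => ?_)⟩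
  obtain ⟨ρ, hρ⟩ := hρ c
  -- It suffices to bound the injective dimension of the free module `F` on the elements of `P`.
  let F := ModuleCat.of Rᵐᵒᵖ (P →₀ Rᵐᵒᵖ)
  have hF : Projective F := (IsProjective.iff_projective _).1 inferInstance
  let π : F ⟶ P := ModuleCat.homEquiv.symm (Finsupp.linearCombination Rᵐᵒᵖ id)
  have : Epi π := (ModuleCat.epi_iff_surjective π).2 (Finsupp.linearCombination_id_surjective _ _)
  obtain ⟨r⟩ := nonempty_retract_of_epi π
  obtain ⟨r'⟩ := RightMod.exists_retract_value_coind_of_retraction (B c) ρ hρ P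
  have : Projective (RightMod.coind (k := k) (fun _ : PUnit.{u + 1} => a c) fun _ => F) :=
    RightMod.projective_coind (b := fun _ => c) (τ := fun _ => τ c)
      (RightMod.isLocallyFiniteFamily_of_finite _) fun _ => B c
  have := RightMod.hasInjectiveDimensionLE_value (B c) (h.injectiveDimension_le
    (RightMod.coind (k := k) (fun _ : PUnit.{u + 1} => a c) fun _ => F))
  have := r'.hasInjectiveDimensionLT (n' + 1)
  exact r.hasInjectiveDimensionLT (n' + 1)
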